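/- Let $T\subseteq\omega^{<\omega}$ be a computable tree in which every node lies on an infinite path, which is finite-branching with computable branching (the number of immediate successors of a node is computable from the node) and has no isolated paths. Suppose the set $[T]$ of infinite paths carries a torsion-free abelian group structure $\mathcal A_T$ whose addition is computed by a Turing functional $\Phi$ (that is, $\Phi^{P\oplus Q}=P+Q$ for all $P,Q\in[T]$). An *existential-atomic* formula is one of the form $\exists G\,\alpha(F_1,\dots,F_n,G)$ with $\alpha$ atomic in the language of groups; it is *properly* existential-atomic if no atomic formula without $G$ is equivalent to $\alpha$ under the axioms for abelian groups. Assume: (i) every properly existential-atomic formula defines a clopen subset of $[T]^n$, and a single Turing functional, given the Gödel number of the formula and the oracle $f_1\oplus\dots\oplus f_n$, decides whether $\vec f\in[T]^n$ lies in that subset; (ii) for every properly existential-atomic formula $\exists G\,\alpha$ and every $\vec f\in[T]^n$ there is at most one $g\in[T]$ with $\mathcal A_T\models\alpha(\vec f,g)$, and a single Turing functional, given the Gödel number of the formula and the oracle $f_1\oplus\dots\oplus f_n$, computes this $g$ whenever it exists. Let $\delta(F_1,\dots,F_n,G)$ be a formula in the language of groups that is equivalent in $\mathcal A_T$ to a formula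 in prenex normal form (with arbitrary quantifiers) whose matrix is a conjunction of literals (atomic formulas and negations of atomic formulas). Then $\exists G\,\delta$ has a computable Skolem function: there are a partial function $S:[T]^n\rightharpoonup[T]$, whose domain contains every $\vec f$ with $\mathcal A_T\models\exists G\,\delta(\vec f,G)$ and for which $\mathcal A_T\models\delta(\vec f,S(\vec f))$ for every such $\vec f$, and a Turing functional $\Psi$ such that $\Psi^{f_1\oplus\dots\oplus f_n}$ is total and equal to $S(\vec f)$ for every $\vec f$ in the domain of $S$. All the hypotheses above (and hence the conclusion) hold for the following two presentations. (a) For every prime $p$, the tree $T_p^+$ of all finite sequences $(k_1,\dots,k_m)$ with $0\le k_i<p^i$ and $k_{i+1}\equiv k_i \bmod p^i$, with the addition $(j_i)_i+(k_i)_i=(j_i+k_i\bmod p^i)_i$ on paths, which presents the additive group $\mathbb Z_p^+$ of $p$-adic integers. (b) The direct product of the trees $T_p^+$ over all primes $p$ (with $p_0<p_1<\cdots$ the primes and $\langle\cdot,\cdot\rangle$ a standard computable pairing function, level $\langle i,l\rangle$ of the product replicates level $l$ of $T_{p_i}^+$), with coordinatewise addition, which presents the profinite completion $\widehat{\mathbb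 Z}$ of $\mathbb Z$. -/

import Mathlib

open FirstOrder FirstOrder.Language

/-! ### Turing functionals -/

/-- `IsTuringFunctional Φ` says that `X, m ↦ Φ^X(m)` is a Turing functional: it is partial
recursive uniformly in the oracle `X : ℕ → ℕ`. This is the uniform version of
`Nat.RecursiveIn`, with the same clauses. -/
inductive IsTuringFunctional : ((ℕ → ℕ) → ℕ →. ℕ) → Prop
  | zero : IsTuringFunctional fun _ _ => Part.some 0
  | succ : IsTuringFunctional fun _ m => Part.some (m + 1)
  | left : IsTuringFunctional fun _ m => Part.some (Nat.unpair m).1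
  | right : IsTuringFunctional fun _ m => Part.some (Nat.unpair m).2
  | oracle : IsTuringFunctional fun X m => Part.some (X m)
  | pair {Φ Ψ : (ℕ → ℕ) → ℕ →. ℕ} (hΦ : IsTuringFunctional Φ) (hΨ : IsTuringFunctional Ψ) :
      IsTuringFunctional fun X m => Nat.pair <$> Φ X m <*> Ψ X m
  | comp {Φ Ψ : (ℕ → ℕ) → ℕ →. ℕ} (hΦ : IsTuringFunctional Φ) (hΨ : IsTuringFunctional Ψ) :
      IsTuringFunctional fun X m => Ψ X m >>= Φ X
  | prec {Φ Ψ : (ℕ → ℕ) → ℕ →. ℕ} (hΦ : IsTuringFunctional Φ) (hΨ : IsTuringFunctional Ψ) :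
      IsTuringFunctional fun X m =>
        (Nat.unpair m).2.rec (Φ X (Nat.unpair m).1) fun y IH => do
          let i ← IH
          Ψ X (Nat.pair (Nat.unpair m).1 (Nat.pair y i))
  | rfind {Φ : (ℕ → ℕ) → ℕ →. ℕ} (hΦ : IsTuringFunctional Φ) :
      IsTuringFunctional fun X m =>
        Nat.rfind fun k => (fun v => v = 0) <$> Φ X (Nat.pair m k)

/-! ### Trees and paths -/

/-- The set `[T]` of infinite paths through `T ⊆ ω^{<ω}`, with the topology inherited from
Baire space. -/
abbrev Paths (T : Set (List ℕ)) : Type :=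
  {P : ℕ → ℕ // ∀ k, (List.range k).map P ∈ T}

/-- The join `f₀ ⊕ ⋯ ⊕ f_{n-1}` of a finite tuple of paths, as a single oracle. -/
def joinOracle {T : Set (List ℕ)} {n : ℕ} (f : Fin n → Paths T) : ℕ → ℕ := fun m =>
  if h : (Nat.unpair m).1 < n then (f ⟨(Nat.unpair m).1, h⟩).1 (Nat.unpair m).2 else 0

/-! ### The language of groups -/

/-- The function symbols `0`, `-`, `+`. -/
inductive GroupFunc : ℕ → Type
  | zero : GroupFunc 0
  | neg : GroupFunc 1
  | add : GroupFunc 2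

/-- The (additive) language of groups; its only relation symbol is equality. -/
def groupLang : FirstOrder.Language.{0, 0} where
  Functions := GroupFunc
  Relations := fun _ => Empty

/-- A number for each function symbol. -/
def groupFuncCode : (Σ i, groupLang.Functions i) → ℕ
  | ⟨_, GroupFunc.zero⟩ => 0
  | ⟨_, GroupFunc.neg⟩ => 1
  | ⟨_, GroupFunc.add⟩ => 2

/-- The function symbol with a given number. -/
def groupFuncDecode : ℕ → Option (Σ i, groupLang.Functions i)
  | 0 => some ⟨0, GroupFunc.zero⟩
  | 1 => some ⟨1, GroupFunc.neg⟩
  | 2 => some ⟨2, GroupFunc.add⟩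
  | _ => none

instance groupFuncEncodable : Encodable (Σ i, groupLang.Functions i) where
  encode := groupFuncCode
  decode := groupFuncDecode
  encodek := by rintro ⟨_, _ | _ | _⟩ <;> rfl

/-- An additive group as a structure for the language of groups. -/
instance groupLangStructure (A : Type*) [AddGroup A] : groupLang.Structure A where
  funMap {_} s v :=
    match s, v with
    | GroupFunc.zero, _ => 0
    | GroupFunc.neg, v => -(v 0)
    | GroupFunc.add, v => v 0 + v 1
  RelMap {_} r _ := nomatch r

/-! ### Formulas

A formula `δ(F₁, …, Fₙ, G)` is a `groupLang.BoundedFormula (Fin n) 1`: the variables `F` are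
indexed by `Fin n`, and `G` is the one further variable. An atomic such formula is an equation
`t₁ = t₂` between terms in these variables. -/

/-- Terms in the variables `F₁, …, Fₙ, G`. -/
abbrev TermFG (n : ℕ) : Type := groupLang.Term (Fin n ⊕ Fin 1)

/-- The existential-atomic formula `∃ G, t₁(F, G) = t₂(F, G)`. -/
def existsEq {n : ℕ} (t₁ t₂ : TermFG n) : groupLang.Formula (Fin n) :=
  (t₁.bdEqual t₂).ex

/-- The Gödel number of the formula `∃ G, t₁(F₁, …, Fₙ, G) = t₂(F₁, …, Fₙ, G)`. -/
def eqCode {n : ℕ} (t₁ t₂ : TermFG n) : ℕ :=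
  Nat.pair n (Nat.pair (Encodable.encode t₁) (Encodable.encode t₂))

/-- `∃ G, t₁ = t₂` is properly existential-atomic: no atomic formula without `G` is equivalent
to `t₁ = t₂` under the axioms for abelian groups. -/
def IsProper {n : ℕ} (t₁ t₂ : TermFG n) : Prop :=
  ¬ ∃ s₁ s₂ : groupLang.Term (Fin n), ∀ (A : Type) [AddCommGroup A] (f : Fin n → A) (g : A),
    (t₁.bdEqual t₂).Realize f (fun _ => g) ↔ s₁.realize f = s₂.realize f

/-- Conjunctions of literals, a literal being an atomic formula or the negation of one. -/
inductive IsLiteralConj {n : ℕ} : ∀ {k : ℕ}, groupLang.BoundedFormula (Fin n) k → Prop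
  | atomic {k : ℕ} {φ : groupLang.BoundedFormula (Fin n) k} (h : φ.IsAtomic) : IsLiteralConj φ
  | neg_atomic {k : ℕ} {φ : groupLang.BoundedFormula (Fin n) k} (h : φ.IsAtomic) :
      IsLiteralConj φ.not
  | inf {k : ℕ} {φ ψ : groupLang.BoundedFormula (Fin n) k} (hφ : IsLiteralConj φ)
      (hψ : IsLiteralConj ψ) : IsLiteralConj (φ ⊓ ψ)

/-- Formulas in prenex normal form whose matrix is a conjunction of literals. -/
inductive IsPrenexConj {n : ℕ} : ∀ {k : ℕ}, groupLang.BoundedFormula (Fin n) k → Prop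
  | matrix {k : ℕ} {φ : groupLang.BoundedFormula (Fin n) k} (h : IsLiteralConj φ) :
      IsPrenexConj φ
  | all {k : ℕ} {φ : groupLang.BoundedFormula (Fin n) (k + 1)} (h : IsPrenexConj φ) :
      IsPrenexConj φ.all
  | ex {k : ℕ} {φ : groupLang.BoundedFormula (Fin n) (k + 1)} (h : IsPrenexConj φ) :
      IsPrenexConj φ.ex

/-! ### The hypotheses -/

/-- A group structure on `[T]` makes `T` a computable tree presentation, with computable finite
branching and no isolated paths, of a torsion-free abelian group, in which properly
existential-atomic formulas define clopen sets with a uniform decision procedure. -/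
structure QESetting (T : Set (List ℕ)) [AddCommGroup (Paths T)] : Prop where
  /-- `T` is a tree. -/
  prefix_closed : ∀ σ τ : List ℕ, σ <+: τ → τ ∈ T → σ ∈ T
  /-- `T` is computable. -/
  computable_tree : ComputablePred fun σ : List ℕ => σ ∈ T
  /-- All nodes are extendible. -/
  extendible : ∀ σ ∈ T, ∃ P : Paths T, (List.range σ.length).map P.1 = σ
  /-- `T` is finite-branching and the number of immediate successors is computable. -/
  computable_branching : ∃ b : List ℕ → ℕ, Computable b ∧
    ∀ σ ∈ T, {m : ℕ | σ ++ [m] ∈ T}.Finite ∧ {m : ℕ | σ ++ [m] ∈ T}.ncard = b σ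
  /-- No path is isolated. -/
  no_isolated : ∀ (P : Paths T) (k : ℕ), ∃ Q : Paths T, Q ≠ P ∧ ∀ i < k, Q.1 i = P.1 i
  /-- A Turing functional computes the group operation. -/
  computable_add : ∃ Φ, IsTuringFunctional Φ ∧
    ∀ (P Q : Paths T) (k : ℕ), Φ (joinOracle ![P, Q]) k = Part.some ((P + Q).1 k)
  /-- The group is torsion-free. -/
  torsion_free : ∀ (m : ℕ) (P : Paths T), m ≠ 0 → m • P = 0 → P = 0
  /-- Properly existential-atomic formulas define clopen sets. -/
  clopen : ∀ (n : ℕ) (t₁ t₂ : TermFG n), IsProper t₁ t₂ →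
    IsClopen {f : Fin n → Paths T | (existsEq t₁ t₂).Realize f}
  /-- Membership in these sets is decided uniformly in the formula. -/
  decidable : ∃ Θ, IsTuringFunctional Θ ∧
    ∀ (n : ℕ) (t₁ t₂ : TermFG n), IsProper t₁ t₂ → ∀ f : Fin n → Paths T,
      ((existsEq t₁ t₂).Realize f → Θ (joinOracle f) (eqCode t₁ t₂) = Part.some 1) ∧
      (¬ (existsEq t₁ t₂).Realize f → Θ (joinOracle f) (eqCode t₁ t₂) = Part.some 0)

/-- In addition, witnesses to properly existential-atomic formulas are unique when they exist,
and they are computed by one Turing functional uniformly in the formula and the parameters. -/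
structure SkolemSetting (T : Set (List ℕ)) [AddCommGroup (Paths T)] : Prop
    extends QESetting T where
  /-- Witnesses are unique. -/
  unique_witness : ∀ (n : ℕ) (t₁ t₂ : TermFG n), IsProper t₁ t₂ →
    ∀ (f : Fin n → Paths T) (g g' : Paths T),
      (t₁.bdEqual t₂).Realize f (fun _ => g) → (t₁.bdEqual t₂).Realize f (fun _ => g') → g = g'
  /-- Witnesses are uniformly computable. -/
  computable_witness : ∃ Ψ, IsTuringFunctional Ψ ∧
    ∀ (n : ℕ) (t₁ t₂ : TermFG n), IsProper t₁ t₂ → ∀ (f : Fin n → Paths T) (g : Paths T),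
      (t₁.bdEqual t₂).Realize f (fun _ => g) →
        ∀ k, Ψ (joinOracle f) (Nat.pair (eqCode t₁ t₂) k) = Part.some (g.1 k)

/-! ### Skolem functions -/

/-- The partial function `S` is a (generalized) Skolem function for `∃ G, δ(F, G)`: it is defined
at every tuple `f` that satisfies `∃ G, δ(f, G)`, and there its value is a witness. -/
def IsSkolemFunction {T : Set (List ℕ)} [AddCommGroup (Paths T)] {n : ℕ}
    (δ : groupLang.BoundedFormula (Fin n) 1) (S : (Fin n → Paths T) →. Paths T) : Prop :=
  ∀ f : Fin n → Paths T, δ.ex.Realize f default → ∃ g ∈ S f, δ.Realize f (fun _ => g)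

/-- A partial function on tuples of paths is computable: a single Turing functional computes the
value from the tuple, for every tuple in the domain. -/
def ComputableOnPaths {T : Set (List ℕ)} {n : ℕ} (S : (Fin n → Paths T) →. Paths T) : Prop :=
  ∃ Ψ, IsTuringFunctional Ψ ∧
    ∀ f : Fin n → Paths T, ∀ g ∈ S f, ∀ k, Ψ (joinOracle f) k = Part.some (g.1 k)

/-- Every `∃ G, δ(F, G)` such that `δ` can be expressed, over the group presented by `T`, in prenex
normal form with a conjunction of literals as matrix has a computable Skolem function. -/
def HasConjunctiveSkolemFunctions (T : Set (List ℕ)) [AddCommGroup (Paths T)] : Prop :=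
  ∀ (n : ℕ) (δ : groupLang.BoundedFormula (Fin n) 1),
    (∃ φ : groupLang.BoundedFormula (Fin n) 1, IsPrenexConj φ ∧
      ∀ (f : Fin n → Paths T) (g : Paths T),
        δ.Realize f (fun _ => g) ↔ φ.Realize f (fun _ => g)) →
    ∃ S : (Fin n → Paths T) →. Paths T, IsSkolemFunction δ S ∧ ComputableOnPaths S

/-! ### The examples -/

/-- The tree `T_p^+`. Positions are counted from `0`, so that position `i` holds a residue
modulo `p ^ (i + 1)`. -/
def padicTree (p : ℕ) : Set (List ℕ) :=
  {σ | (∀ (i : ℕ) (h : i < σ.length), σ[i] < p ^ (i + 1)) ∧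
    ∀ (i : ℕ) (h : i + 1 < σ.length), σ[i + 1] ≡ σ[i] [MOD p ^ (i + 1)]}

/-- The part of the node `σ` that belongs to the `i`-th factor of a product of trees: the entries
at the levels `⟨i, 0⟩, ⟨i, 1⟩, …` below the length of `σ`. -/
def nodeComponent (i : ℕ) (σ : List ℕ) : List ℕ :=
  (List.range σ.length).filterMap fun l => σ[Nat.pair i l]?

/-- The direct product of a sequence of trees: level `⟨i, l⟩` replicates level `l` of `T i`. -/
def prodTree (T : ℕ → Set (List ℕ)) : Set (List ℕ) :=
  {σ | ∀ i, nodeComponent i σ ∈ T i}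

/-- The direct product of the trees `T_p^+` over all primes `p`. -/
def zhatTree : Set (List ℕ) := prodTree fun i => padicTree (Nat.nth Nat.Prime i)

/-! ### Closure properties of Turing functionals -/

namespace IsTuringFunctional

/-! The carrier of the argument is a semantic quantifier elimination. In an infinite torsion-free
abelian group, consider the predicates of the form "linear equations, linear inequations, and a
condition D invariant under translation by multiples of some N ≠ 0" (`IsLinCongruence`). D is kept
as an arbitrary invariant predicate, so no normal form for divisibility conditions is needed.
Conjunctions of literals have this form, and both quantifiers preserve it. For ∃z: an equation with
a nonzero coefficient at z allows z to be eliminated from the other equations and inequations;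
without such an equation, the inequations involving z exclude only finitely many members of an
infinite congruence class and can be dropped. For ∀z: an equation involving z makes the statement
false, and an inequation c(v) + a z ≠ 0 valid for all z says that a does not divide c(v), which is a
congruence condition. Disjunctions are never needed, which is why the matrix has to be a
conjunction.

Apply this to δ(F, G), keeping G. If some equation has a nonzero coefficient at G, it is properly
existential-atomic and its unique solution is computed by hypothesis. Otherwise G is restricted only
by D and by inequations. The cosets of multiples of N are open, because divisibility by N is
properly existential-atomic; addition is continuous by the use principle. Hence the admissible G
form an open set depending on F in an open way, and the set of F for which D is solvable is clopen
in a compact space. Every nonempty open set of paths contains a computable path, so near each F one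
fixed computable path is a correct choice. Compactness reduces this to finitely many cylinders, and
a finite case distinction on the oracle is a Turing functional (`exists_functional_of_locally`).

Both examples are instances of `ResidueSystem`: compatible residues modulo powers of primes, indexed
by component and level. For h + b g = 0 with 0 < |b| ≤ B, multiplication by b costs fewer than B
factors of a prime q. So a solution B levels higher determines g (`solution_modEq`), and solvability
has to be tested only at level B of the components up to B, since larger primes do not divide b
(`exists_solution`). Witnesses are found by search and solvability by a bounded search, uniformly in
the coded equation. The isomorphism with the profinite completion rests on the Chinese remainder
theorem. -/

theorem of_nat_partrec {f : ℕ →. ℕ} (hf : Nat.Partrec f) :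
    IsTuringFunctional fun _ m => f m := by
  induction hf with
  | zero => exact zero
  | succ => exact succ
  | left => exact left
  | right => exact right
  | pair _ _ hf hg => exact pair hf hg
  | comp _ _ hf hg => exact comp hf hg
  | prec _ _ hf hg => exact prec hf hg
  | rfind _ hf => exact rfind hf

theorem of_computable {f : ℕ → ℕ} (hf : Computable f) :
    IsTuringFunctional fun _ m => Part.some (f m) :=
  of_nat_partrec (Partrec.nat_iff.1 hf.partrec)

theorem comp_total {Φ : (ℕ → ℕ) → ℕ →. ℕ} {f : (ℕ → ℕ) → ℕ → ℕ} (hΦ : IsTuringFunctional Φ)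
    (hf : IsTuringFunctional fun X m => Part.some (f X m)) :
    IsTuringFunctional fun X m => Φ X (f X m) := by
  refine (congrArg IsTuringFunctional ?_).mp (comp hΦ hf)
  funext X m
  exact Part.bind_some _ _

theorem pair_total {f g : (ℕ → ℕ) → ℕ → ℕ}
    (hf : IsTuringFunctional fun X m => Part.some (f X m))
    (hg : IsTuringFunctional fun X m => Part.some (g X m)) :
    IsTuringFunctional fun X m => Part.some (Nat.pair (f X m) (g X m)) := by
  simpa [Seq.seq] using pair hf hg

/-- The functional that computes the code of the initial segment of the oracle of given length. -/
theorem initialSegment : IsTuringFunctional fun X m =>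
    Part.some (Encodable.encode ((List.range m).map X)) := by
  -- The recursion step appends the oracle value X y to the segment already coded. In `prec`, the
  -- step receives the pair of the parameter, here 0, and the pair of y and that code.
  have hstep : Computable fun m : ℕ => Encodable.encode
      (((Encodable.decode (α := List ℕ) m.unpair.1).getD []) ++ [m.unpair.2]) := by
    refine Computable.encode.comp (Primrec.to_comp ?_)
    refine Primrec.list_append.comp
      (Primrec.option_getD.comp (Primrec.decode.comp (Primrec.fst.comp Primrec.unpair))
        (Primrec.const [])) ?_
    exact Primrec.list_cons.comp (Primrec.snd.comp Primrec.unpair) (Primrec.const [])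
  have hright : IsTuringFunctional fun _ m => Part.some m.unpair.2 := right
  have hy := comp_total hright hright
  have hy1 : IsTuringFunctional fun X m => Part.some (m.unpair.2.unpair.1) :=
    comp_total (Φ := fun _ m => Part.some m.unpair.1) left hright
  have hv : IsTuringFunctional fun X m => Part.some (X m.unpair.2.unpair.1) :=
    comp_total (Φ := fun X m => Part.some (X m)) oracle hy1
  have hΨ := comp_total (of_computable hstep) (pair_total hy hv)
  have h0 : IsTuringFunctional fun _ _ => Part.some (Encodable.encode ([] : List ℕ)) :=
    of_computable (Computable.const _)
  have hm : IsTuringFunctional fun _ m => Part.some (Nat.pair 0 m) :=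
    of_computable (Primrec₂.natPair.comp (Primrec.const 0) Primrec.id).to_comp
  have h := comp_total (prec h0 hΨ) hm
  refine (congrArg IsTuringFunctional ?_).mp h
  funext X m
  simp only [Nat.unpair_pair]
  induction m with
  | zero => rfl
  | succ m ih =>
    simp only
    rw [ih]
    simp [List.range_succ]

/-- A partial recursive function of the input and of an initial segment of the oracle whose length
is computable from the input gives a Turing functional. -/
theorem of_initialSegment {B : ℕ → ℕ} {g : ℕ × List ℕ →. ℕ} (hB : Computable B)
    (hg : Partrec g) :
    IsTuringFunctional fun X m => g (m, (List.range (B m)).map X) := by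
  have hpre := comp_total initialSegment (of_computable hB)
  have hid : IsTuringFunctional fun _ m => Part.some m := of_computable Computable.id
  have h2 : Partrec fun m : ℕ =>
      g (m.unpair.1, (Encodable.decode (α := List ℕ) m.unpair.2).getD []) := by
    refine hg.comp ((Computable.fst.comp Computable.unpair).pair ?_)
    exact Computable.option_getD (Computable.decode.comp (Computable.snd.comp Computable.unpair))
      (Computable.const [])
  have h := comp_total (of_nat_partrec (Partrec.nat_iff.1 h2)) (pair_total hid hpre)
  simpa using h

theorem of_initialSegment_total {B : ℕ → ℕ} {g : ℕ × List ℕ → ℕ} (hB : Computable B)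
    (hg : Computable g) :
    IsTuringFunctional fun X m => Part.some (g (m, (List.range (B m)).map X)) :=
  of_initialSegment hB hg.partrec

/-- If the oracle takes the value `v` at `a` then use `f`, else use `g`. -/
theorem ite_oracle {f g : (ℕ → ℕ) → ℕ → ℕ}
    (hf : IsTuringFunctional fun X m => Part.some (f X m))
    (hg : IsTuringFunctional fun X m => Part.some (g X m)) (a v : ℕ) :
    IsTuringFunctional fun X m => Part.some (if X a = v then f X m else g X m) := by
  have ha : IsTuringFunctional fun X _ => Part.some (X a) :=
    comp_total (Φ := fun X m => Part.some (X m)) oracle (of_computable (Computable.const a))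
  have hq : Computable fun m : ℕ =>
      -- Both branches are total, so both values are computed and one is selected afterwards.
      if m.unpair.1 = v then m.unpair.2.unpair.1 else m.unpair.2.unpair.2 := by
    have h2 := Primrec.snd.comp Primrec.unpair
    exact (Primrec.ite
      (Primrec.eq.comp (Primrec.fst.comp Primrec.unpair) (Primrec.const v))
      (Primrec.fst.comp (Primrec.unpair.comp h2))
      (Primrec.snd.comp (Primrec.unpair.comp h2))).to_comp
  simpa using comp_total (of_computable hq) (pair_total ha (pair_total hf hg))

/-- The use principle. -/
theorem exists_use {Φ : (ℕ → ℕ) → ℕ →. ℕ} (hΦ : IsTuringFunctional Φ) (X : ℕ → ℕ) :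
    ∀ m v, v ∈ Φ X m → ∃ K, ∀ Y : ℕ → ℕ, (∀ i < K, Y i = X i) → v ∈ Φ Y m := by
  induction hΦ with
  | zero => exact fun m v h => ⟨0, fun Y _ => h⟩
  | succ => exact fun m v h => ⟨0, fun Y _ => h⟩
  | left => exact fun m v h => ⟨0, fun Y _ => h⟩
  | right => exact fun m v h => ⟨0, fun Y _ => h⟩
  | oracle =>
    intro m v h
    refine ⟨m + 1, fun Y hY => ?_⟩
    have h' : v ∈ Part.some (X m) := h
    rw [← hY m (by omega)] at h'
    exact h'
  | pair _ _ h1 h2 =>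
    intro m v h
    simp only [Seq.seq, Part.map_eq_map, Part.mem_bind_iff, Part.mem_map_iff,
      exists_exists_and_eq_and] at h ⊢
    obtain ⟨a, ha, b, hb, rfl⟩ := h
    obtain ⟨K1, hK1⟩ := h1 m a ha
    obtain ⟨K2, hK2⟩ := h2 m b hb
    exact ⟨max K1 K2, fun Y hY => ⟨a, hK1 Y fun i hi => hY i (lt_max_of_lt_left hi), b,
      hK2 Y fun i hi => hY i (lt_max_of_lt_right hi), rfl⟩⟩
  | comp _ _ h1 h2 =>
    intro m v h
    obtain ⟨a, ha, hb⟩ := Part.mem_bind_iff.1 h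
    obtain ⟨K1, hK1⟩ := h2 m a ha
    obtain ⟨K2, hK2⟩ := h1 a v hb
    exact ⟨max K1 K2, fun Y hY => Part.mem_bind_iff.2
      ⟨a, hK1 Y fun i hi => hY i (lt_max_of_lt_left hi), hK2 Y fun i hi => hY i (lt_max_of_lt_right hi)⟩⟩
  | prec _ _ h1 h2 =>
    intro m
    simp only
    generalize (Nat.unpair m).2 = n
    induction n with
    | zero => exact fun v h => h1 _ v h
    | succ n ih =>
      intro v h
      simp only [Part.bind_eq_bind, Part.mem_bind_iff] at h ⊢
      obtain ⟨a, ha, hb⟩ := h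
      obtain ⟨K1, hK1⟩ := ih a ha
      obtain ⟨K2, hK2⟩ := h2 _ v hb
      exact ⟨max K1 K2, fun Y hY => ⟨a, hK1 Y fun i hi => hY i (lt_max_of_lt_left hi),
        hK2 Y fun i hi => hY i (lt_max_of_lt_right hi)⟩⟩
  | @rfind Φ _ h1 =>
    intro m v h
    obtain ⟨h, hlt⟩ := Nat.mem_rfind.1 h
    obtain ⟨a, ha, ha'⟩ := (Part.mem_map_iff _).1 h
    obtain ⟨K1, hK1⟩ := h1 _ a ha
    have h3 : ∀ j, ∃ K, j < v → ∀ Y : ℕ → ℕ, (∀ i < K, Y i = X i) →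
        ∃ a ∈ Φ Y (Nat.pair m j), decide (a = 0) = false := by
      intro j
      by_cases hj : j < v
      · obtain ⟨b, hb, hb'⟩ := (Part.mem_map_iff _).1 (hlt hj)
        obtain ⟨K, hK⟩ := h1 _ b hb
        exact ⟨K, fun _ Y hY => ⟨b, hK Y hY, hb'⟩⟩
      · exact ⟨0, fun h => absurd h hj⟩
    -- A successful search makes finitely many computations, so the maximum of their uses suffices.
    choose K hK using h3
    refine ⟨max K1 ((Finset.range v).sup K), fun Y hY => Nat.mem_rfind.2
      ⟨(Part.mem_map_iff _).2 ⟨a, hK1 Y fun i hi => hY i (lt_max_of_lt_left hi), ha'⟩,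
        fun {j} hj => (Part.mem_map_iff _).2 ?_⟩⟩
    exact hK j hj Y fun i hi => hY i (lt_max_of_lt_right
      (hi.trans_le (Finset.le_sup (Finset.mem_range.2 hj))))

end IsTuringFunctional

/-! ### Linear forms and quantifier elimination -/

/-- The coefficient of the variable `x` in a term of the language of groups. -/
def termCoeff {α : Type*} [DecidableEq α] (x : α) : groupLang.Term α → ℤ
  | .var y => if y = x then 1 else 0
  | .func GroupFunc.zero _ => 0
  | .func GroupFunc.neg ts => -termCoeff x (ts 0)
  | .func GroupFunc.add ts => termCoeff x (ts 0) + termCoeff x (ts 1)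

/-- The value of the linear form with integer coefficients `c` at `v`. -/
def linForm {α A : Type*} [Fintype α] [AddCommGroup A] (c : α → ℤ) (v : α → A) : A :=
  ∑ x, c x • v x

section LinForm

variable {α A : Type*} [Fintype α] [AddCommGroup A]

theorem linForm_add_right (c : α → ℤ) (v w : α → A) :
    linForm c (v + w) = linForm c v + linForm c w := by
  simp [linForm, Finset.sum_add_distrib]

theorem linForm_smul_right (c : α → ℤ) (m : ℤ) (v : α → A) :
    linForm c (m • v) = m • linForm c v := by
  simp only [linForm, Finset.smul_sum, Pi.smul_apply]
  exact Finset.sum_congr rfl fun x _ => smul_comm _ _ _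

theorem linForm_sub_left (c d : α → ℤ) (v : α → A) :
    linForm (c - d) v = linForm c v - linForm d v := by
  simp [linForm, sub_smul]

theorem linForm_smul_left (m : ℤ) (c : α → ℤ) (v : α → A) :
    linForm (m • c) v = m • linForm c v := by
  simp [linForm, Finset.smul_sum, mul_smul]

theorem realize_eq_linForm [DecidableEq α] (t : groupLang.Term α) (v : α → A) :
    t.realize v = linForm (fun x => termCoeff x t) v := by
  induction t with
  | var y => simp [linForm, termCoeff]
  | func f ts ih =>
    cases f with
    | zero => simp [linForm, termCoeff]; rfl
    | neg =>
      have h : (Term.func GroupFunc.neg ts : groupLang.Term α).realize v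
        = -(ts 0).realize v := rfl
      rw [h, ih]
      simp [linForm, termCoeff]
    | add =>
      have h : (Term.func GroupFunc.add ts : groupLang.Term α).realize v
        = (ts 0).realize v + (ts 1).realize v := rfl
      rw [h, ih, ih]
      simp [linForm, termCoeff, add_smul, Finset.sum_add_distrib]

theorem realize_eq_realize_iff [DecidableEq α] (t₁ t₂ : groupLang.Term α) (v : α → A) :
    t₁.realize v = t₂.realize v ↔
      linForm (fun x => termCoeff x t₁ - termCoeff x t₂) v = 0 := by
  rw [realize_eq_linForm, realize_eq_linForm, ← sub_eq_zero]
  exact iff_of_eq (congrArg (· = 0) (linForm_sub_left _ _ v).symm)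

end LinForm

/-- The predicate `P` on tuples from `A` is the conjunction of a system of linear equations, a
system of linear inequations, and a congruence condition modulo some `N ≠ 0`. -/
def IsLinCongruence {α A : Type*} [Fintype α] [AddCommGroup A] (P : (α → A) → Prop) : Prop :=
  ∃ (E I : List (α → ℤ)) (N : ℤ) (D : (α → A) → Prop), N ≠ 0 ∧
    (∀ v w, D v → D (v + N • w)) ∧
    ∀ v, P v ↔ (∀ e ∈ E, linForm e v = 0) ∧ (∀ e ∈ I, linForm e v ≠ 0) ∧ D v

/-- A variant of `IsLinCongruence` for predicates in which one variable is singled out. -/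
def IsLinCongruence₂ {α A : Type*} [Fintype α] [AddCommGroup A] (P : (α → A) → A → Prop) : Prop :=
  ∃ (E I : List ((α → ℤ) × ℤ)) (N : ℤ) (D : (α → A) → A → Prop), N ≠ 0 ∧
    (∀ v w z y, D v z → D (v + N • w) (z + N • y)) ∧
    ∀ v z, P v z ↔ (∀ e ∈ E, linForm e.1 v + e.2 • z = 0) ∧
      (∀ e ∈ I, linForm e.1 v + e.2 • z ≠ 0) ∧ D v z

/-! ### Elimination of one quantifier -/

section Elimination

variable {α A : Type*} [Fintype α] [AddCommGroup A]

theorem IsLinCongruence.and {P Q : (α → A) → Prop} (hP : IsLinCongruence P)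
    (hQ : IsLinCongruence Q) : IsLinCongruence fun v => P v ∧ Q v := by
  obtain ⟨E, I, N, D, hN, hD, h⟩ := hP
  obtain ⟨E', I', N', D', hN', hD', h'⟩ := hQ
  refine ⟨E ++ E', I ++ I', N * N', fun v => D v ∧ D' v, mul_ne_zero hN hN',
    fun v w hv => ⟨?_, ?_⟩, fun v => ?_⟩
  · rw [mul_smul]; exact hD _ _ hv.1
  · rw [mul_comm, mul_smul]; exact hD' _ _ hv.2
  · simp only [h, h', List.mem_append, or_imp, forall_and]
    tauto

/-- In a torsion-free group an equation with a nonzero coefficient has at most one solution. -/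
theorem linear_solution_unique (htf : ∀ (m : ℤ) (z : A), m ≠ 0 → m • z = 0 → z = 0) {s : A}
    {a : ℤ} (ha : a ≠ 0) {z z' : A} (h : s + a • z = 0) (h' : s + a • z' = 0) : z = z' := by
  refine sub_eq_zero.1 (htf a _ ha ?_)
  rw [smul_sub, sub_eq_zero]
  exact add_left_cancel (h.trans h'.symm)

/-- Congruence classes are infinite, so finitely many linear inequations can be avoided. -/
theorem exists_congruent_avoiding [Infinite A]
    (htf : ∀ (m : ℤ) (z : A), m ≠ 0 → m • z = 0 → z = 0) (I : List ((α → ℤ) × ℤ)) {N : ℤ}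
    (hN : N ≠ 0) (v : α → A) (z : A) :
    ∃ y : A, ∀ e ∈ I, e.2 ≠ 0 → linForm e.1 v + e.2 • (z + N • y) ≠ 0 := by
  have hfin : (⋃ e ∈ {e | e ∈ I ∧ e.2 ≠ 0},
      {y : A | linForm e.1 v + e.2 • (z + N • y) = 0}).Finite := by
    refine Set.Finite.biUnion ((List.finite_toSet I).subset fun e he => he.1) fun e he => ?_
    refine Set.Subsingleton.finite fun y hy y' hy' => ?_
    have h := add_left_cancel (linear_solution_unique htf he.2 hy hy')
    refine sub_eq_zero.1 (htf N _ hN ?_)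
    rw [smul_sub, h, sub_self]
  obtain ⟨y, hy⟩ := hfin.exists_notMem
  refine ⟨y, fun e he h0 h => hy ?_⟩
  simp only [Set.mem_iUnion]
  exact ⟨e, ⟨he, h0⟩, h⟩

theorem forall_fst_mem_filter {β : Type*} (I : List (β × ℤ)) (p : β → Prop) :
    (∀ c ∈ (I.filter fun e => e.2 = 0).map Prod.fst, p c) ↔ ∀ e ∈ I, e.2 = 0 → p e.1 := by
  constructor
  · intro h e he h0
    exact h _ (List.mem_map.2 ⟨e, List.mem_filter.2 ⟨he, by simpa using h0⟩, rfl⟩)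
  · intro h c hc
    obtain ⟨e, he, rfl⟩ := List.mem_map.1 hc
    obtain ⟨he, h0⟩ := List.mem_filter.1 he
    exact h e he (by simpa using h0)

/-- Either an equation s(v) + a z = 0 with a ≠ 0 pins z down and is used for substitution, or z
occurs only in inequations and in D, where infinitely many values within a congruence class are
available. -/
theorem IsLinCongruence₂.exists [Infinite A]
    (htf : ∀ (m : ℤ) (z : A), m ≠ 0 → m • z = 0 → z = 0)
    {P : (α → A) → A → Prop} (hP : IsLinCongruence₂ P) : IsLinCongruence fun v => ∃ z, P v z := by
  obtain ⟨E, I, N, D, hN, hD, h⟩ := hP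
  by_cases hE : ∃ e ∈ E, e.2 ≠ 0
  · obtain ⟨⟨s, a⟩, he0, ha⟩ := hE
    simp only [ne_eq] at ha
    -- Cross-multiplication: a times the form e, with a z replaced by -s(v), no longer contains z.
    -- Cancelling a uses torsion-freeness.
    have key : ∀ (e : (α → ℤ) × ℤ) (v : α → A) (z : A), linForm s v + a • z = 0 →
        (linForm (a • e.1 - e.2 • s) v = 0 ↔ linForm e.1 v + e.2 • z = 0) := by
      intro e v z hz
      have h1 : linForm (a • e.1 - e.2 • s) v = a • (linForm e.1 v + e.2 • z) := by
        rw [linForm_sub_left, linForm_smul_left, linForm_smul_left,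
          eq_neg_of_add_eq_zero_left hz, smul_add, smul_neg, sub_neg_eq_add,
          smul_comm e.2 a z]
      rw [h1]
      exact ⟨htf a _ ha, fun h => by rw [h, smul_zero]⟩
    refine ⟨E.map fun e => a • e.1 - e.2 • s, I.map fun e => a • e.1 - e.2 • s, N * a,
      fun v => ∃ z, linForm s v + a • z = 0 ∧ D v z, mul_ne_zero hN ha, ?_, fun v => ?_⟩
    · rintro v w ⟨z, hz, hDz⟩
      -- If v moves by N a w, then s(v) moves by N a s(w), and moving z by -N s(w) restores the
      -- equation. This is why the modulus is N a.
      refine ⟨z + N • -linForm s w, ?_, ?_⟩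
      · rw [linForm_add_right, linForm_smul_right, smul_add, mul_comm, mul_smul, smul_neg,
          smul_neg]
        rw [add_add_add_comm, hz, zero_add, add_neg_cancel]
      · rw [mul_smul]
        exact hD _ _ _ _ hDz
    · simp only [List.mem_map, forall_exists_index, and_imp, forall_apply_eq_imp_iff₂]
      constructor
      · rintro ⟨z, hz⟩
        obtain ⟨h1, h2, h3⟩ := (h v z).1 hz
        have hz0 := h1 _ he0
        exact ⟨fun e he => (key e v z hz0).2 (h1 e he),
          fun e he => mt (key e v z hz0).1 (h2 e he), z, hz0, h3⟩
      · rintro ⟨h1, h2, z, hz0, h3⟩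
        exact ⟨z, (h v z).2 ⟨fun e he => (key e v z hz0).1 (h1 e he),
          fun e he => mt (key e v z hz0).2 (h2 e he), h3⟩⟩
  · push Not at hE
    refine ⟨E.map Prod.fst, (I.filter fun e => e.2 = 0).map Prod.fst, N, fun v => ∃ z, D v z, hN,
      ?_, fun v => ?_⟩
    · rintro v w ⟨z, hz⟩
      exact ⟨z + N • 0, hD _ _ _ _ hz⟩
    · rw [forall_fst_mem_filter]
      simp only [List.mem_map, forall_exists_index, and_imp, forall_apply_eq_imp_iff₂]
      constructor
      · rintro ⟨z, hz⟩
        obtain ⟨h1, h2, h3⟩ := (h v z).1 hz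
        refine ⟨fun e he => ?_, fun e he h0 => ?_, z, h3⟩
        · simpa [hE e he] using h1 e he
        · simpa [h0] using h2 e he
      · rintro ⟨h1, h2, z, h3⟩
        obtain ⟨y, hy⟩ := exists_congruent_avoiding htf I hN v z
        refine ⟨z + N • y, (h _ _).2 ⟨fun e he => ?_, fun e he => ?_, ?_⟩⟩
        · simpa [hE e he] using h1 e he
        · by_cases h0 : e.2 = 0
          · simpa [h0] using h2 e he h0
          · exact hy e he h0
        · simpa using hD v 0 z y h3

/-- An equation with a nonzero coefficient at z cannot hold at two different values of z. Without
one, an inequation involving z turns into the failure of a divisibility, which depends only on v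
modulo its coefficient. -/
theorem IsLinCongruence₂.forall [Infinite A]
    (htf : ∀ (m : ℤ) (z : A), m ≠ 0 → m • z = 0 → z = 0)
    {P : (α → A) → A → Prop} (hP : IsLinCongruence₂ P) : IsLinCongruence fun v => ∀ z, P v z := by
  obtain ⟨E, I, N, D, hN, hD, h⟩ := hP
  by_cases hE : ∃ e ∈ E, e.2 ≠ 0
  · obtain ⟨e, he, h0⟩ := hE
    refine ⟨[], [], 1, fun _ => False, one_ne_zero, fun _ _ h => h, fun v => ?_⟩
    simp only [and_false, iff_false]
    intro hz
    obtain ⟨x, y, hxy⟩ := exists_pair_ne A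
    exact hxy (linear_solution_unique htf h0 (((h v x).1 (hz x)).1 e he)
      (((h v y).1 (hz y)).1 e he))
  · push Not at hE
    -- M is a common nonzero multiple of all nonzero coefficients of z in the inequations.
    set M : ℤ := (I.map fun e => if e.2 = 0 then 1 else e.2).prod with hM
    have hdvd : ∀ e ∈ I, e.2 ≠ 0 → e.2 ∣ M := by
      intro e he h0
      refine List.dvd_prod (List.mem_map.2 ⟨e, he, ?_⟩)
      simp [h0]
    have hM0 : M ≠ 0 := by
      refine List.prod_ne_zero fun h => ?_
      obtain ⟨e, -, he⟩ := List.mem_map.1 h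
      split_ifs at he with h0
      · exact one_ne_zero he
      · exact h0 he
    refine ⟨E.map Prod.fst, (I.filter fun e => e.2 = 0).map Prod.fst, N * M,
      fun v => (∀ z, D v z) ∧ ∀ e ∈ I, e.2 ≠ 0 → ∀ z, linForm e.1 v + e.2 • z ≠ 0,
      mul_ne_zero hN hM0, ?_, fun v => ?_⟩
    · rintro v w ⟨hz, hI⟩
      refine ⟨fun z => ?_, fun e he h0 z hz => ?_⟩
      · rw [mul_smul]
        simpa using hD v (M • w) z 0 (hz z)
      · obtain ⟨c, hc⟩ := hdvd e he h0
        -- With M = e.2 * c, the change N M e.1(w) of the constant part is absorbed by moving z by N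
        -- c e.1(w).
        refine hI e he h0 (z + (N * c) • linForm e.1 w) ?_
        rw [← hz, linForm_add_right, linForm_smul_right, smul_add, smul_smul, hc]
        rw [show e.2 * (N * c) = N * (e.2 * c) by ring]
        abel
    · rw [forall_fst_mem_filter]
      simp only [List.mem_map, forall_exists_index, and_imp, forall_apply_eq_imp_iff₂, h]
      constructor
      · intro hz
        refine ⟨fun e he => ?_, fun e he h0 => ?_, fun z => (hz z).2.2,
          fun e he _ z => (hz z).2.1 e he⟩
        · simpa [hE e he] using (hz 0).1 e he
        · simpa [h0] using (hz 0).2.1 e he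
      · rintro ⟨h1, h2, h3, h4⟩ z
        refine ⟨fun e he => ?_, fun e he => ?_, h3 z⟩
        · simpa [hE e he] using h1 e he
        · by_cases h0 : e.2 = 0
          · simpa [h0] using h2 e he h0
          · exact h4 e he h0 z

end Elimination

/-! ### Prenex formulas with conjunctive matrix -/

section Prenex

variable {A : Type*} [AddCommGroup A] {n : ℕ}

/-- The coefficients of a linear form with the last variable singled out. -/
def splitLast {k : ℕ} (c : Fin n ⊕ Fin (k + 1) → ℤ) : (Fin n ⊕ Fin k → ℤ) × ℤ :=
  (Sum.elim (fun i => c (.inl i)) fun i => c (.inr i.castSucc), c (.inr (Fin.last k)))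

theorem linForm_snoc {k : ℕ} (c : Fin n ⊕ Fin (k + 1) → ℤ) (f : Fin n → A) (x : Fin k → A)
    (z : A) : linForm c (Sum.elim f (Fin.snoc x z : Fin (k + 1) → A)) =
      linForm (splitLast c).1 (Sum.elim f x) + (splitLast c).2 • z := by
  simp [linForm, splitLast, Fin.sum_univ_castSucc, add_assoc]

theorem IsLinCongruence.split {k : ℕ} {P : (Fin n ⊕ Fin (k + 1) → A) → Prop}
    (hP : IsLinCongruence P) : IsLinCongruence₂ fun (v : Fin n ⊕ Fin k → A) z =>
      P (Sum.elim (fun i => v (.inl i)) (Fin.snoc (fun i => v (.inr i)) z : Fin (k + 1) → A)) := by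
  obtain ⟨E, I, N, D, hN, hD, h⟩ := hP
  have hv : ∀ v : Fin n ⊕ Fin k → A, Sum.elim (fun i => v (.inl i)) (fun i => v (.inr i)) = v :=
    fun v => Sum.elim_comp_inl_inr v
  refine ⟨E.map splitLast, I.map splitLast, N, fun v z => D (Sum.elim (fun i => v (.inl i))
    (Fin.snoc (fun i => v (.inr i)) z : Fin (k + 1) → A)), hN, fun v w z y hz => ?_,
    fun v z => ?_⟩
  · convert hD _ (Sum.elim (fun i => w (.inl i))
      (Fin.snoc (fun i => w (.inr i)) y : Fin (k + 1) → A)) hz using 1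
    ext (i | i)
    · simp
    · refine Fin.lastCases ?_ (fun i => ?_) i <;> simp
  · simp only [h, List.mem_map, forall_exists_index, and_imp, forall_apply_eq_imp_iff₂,
      linForm_snoc, hv]

/-- The predicate on tuples defined by a formula. -/
def definedPred (A : Type*) [AddCommGroup A] {k : ℕ} (φ : groupLang.BoundedFormula (Fin n) k)
    (v : Fin n ⊕ Fin k → A) : Prop :=
  φ.Realize (fun i => v (.inl i)) fun i => v (.inr i)

theorem exists_linForm_of_isAtomic {k : ℕ} {φ : groupLang.BoundedFormula (Fin n) k}
    (h : φ.IsAtomic) : ∃ c, ∀ v : Fin n ⊕ Fin k → A, definedPred A φ v ↔ linForm c v = 0 := by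
  cases h with
  | equal t₁ t₂ =>
    refine ⟨fun x => termCoeff x t₁ - termCoeff x t₂, fun v => ?_⟩
    rw [← realize_eq_realize_iff t₁ t₂ v, definedPred, BoundedFormula.realize_bdEqual]
    rw [show Sum.elim (fun i => v (.inl i)) (fun i => v (.inr i)) = v from
      Sum.elim_comp_inl_inr v]
  | rel R => exact nomatch R

theorem IsLiteralConj.isLinCongruence {k : ℕ} {φ : groupLang.BoundedFormula (Fin n) k}
    (h : IsLiteralConj φ) : IsLinCongruence (definedPred A φ) := by
  induction h with
  | atomic h =>
    obtain ⟨c, hc⟩ := exists_linForm_of_isAtomic (A := A) h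
    exact ⟨[c], [], 1, fun _ => True, one_ne_zero, fun _ _ h => h, fun v => by simp [hc]⟩
  | neg_atomic h =>
    obtain ⟨c, hc⟩ := exists_linForm_of_isAtomic (A := A) h
    refine ⟨[], [c], 1, fun _ => True, one_ne_zero, fun _ _ h => h, fun v => ?_⟩
    simp [definedPred, ← hc]
  | inf _ _ h₁ h₂ =>
    refine (congrArg IsLinCongruence ?_).mp (h₁.and h₂)
    funext v
    simp only [definedPred, BoundedFormula.realize_inf]

theorem IsPrenexConj.isLinCongruence [Infinite A]
    (htf : ∀ (m : ℤ) (z : A), m ≠ 0 → m • z = 0 → z = 0)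
    {k : ℕ} {φ : groupLang.BoundedFormula (Fin n) k}
    (h : IsPrenexConj φ) : IsLinCongruence (definedPred A φ) := by
  induction h with
  | matrix h => exact h.isLinCongruence
  | all _ ih => exact ih.split.forall htf
  | ex _ ih =>
    refine (congrArg IsLinCongruence ?_).mp (ih.split.exists htf)
    funext v
    simp only [definedPred, BoundedFormula.realize_ex, Sum.elim_inl, Sum.elim_inr]

end Prenex

/-! ### Terms with prescribed coefficients and proper formulas -/

/-- The coefficient vectors of terms form a subgroup of the integer vectors, and the variables
contribute the unit vectors. This converts linear forms back into terms, to which the hypotheses on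
formulas apply. -/
theorem exists_term_coeff {α : Type*} [Fintype α] [DecidableEq α] (c : α → ℤ) :
    ∃ t : groupLang.Term α, ∀ x, termCoeff x t = c x := by
  let S : AddSubgroup (α → ℤ) :=
    { carrier := Set.range fun (t : groupLang.Term α) x => termCoeff x t
      zero_mem' := ⟨.func GroupFunc.zero Fin.elim0, rfl⟩
      add_mem' := by
        rintro _ _ ⟨t, rfl⟩ ⟨s, rfl⟩
        exact ⟨.func GroupFunc.add ![t, s], rfl⟩
      neg_mem' := by
        rintro _ ⟨t, rfl⟩
        exact ⟨.func GroupFunc.neg ![t], rfl⟩ }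
  have hc : c ∈ S := by
    have h1 : c = ∑ i, c i • (Pi.single i 1 : α → ℤ) := by
      ext x
      simp [Finset.sum_apply, Pi.single_apply]
    rw [h1]
    refine sum_mem fun i _ => zsmul_mem ?_ _
    refine ⟨.var i, funext fun x => ?_⟩
    simp [termCoeff, Pi.single_apply, eq_comm]
  obtain ⟨t, ht⟩ := hc
  exact ⟨t, fun x => congrFun ht x⟩

theorem realize_bdEqual_iff {n : ℕ} {A : Type*} [AddCommGroup A] (t₁ t₂ : TermFG n) (f : Fin n → A)
    (g : A) : (t₁.bdEqual t₂).Realize f (fun _ => g) ↔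
      linForm (fun i => termCoeff (.inl i) t₁ - termCoeff (.inl i) t₂) f +
        (termCoeff (.inr 0) t₁ - termCoeff (.inr 0) t₂) • g = 0 := by
  rw [BoundedFormula.realize_bdEqual, realize_eq_realize_iff]
  simp [linForm]

theorem realize_existsEq_iff {n : ℕ} {A : Type*} [AddCommGroup A] (t₁ t₂ : TermFG n)
    (f : Fin n → A) : (existsEq t₁ t₂).Realize f ↔
      ∃ g, (t₁.bdEqual t₂).Realize f fun _ => g := by
  rw [existsEq, Formula.Realize, BoundedFormula.realize_ex]
  refine exists_congr fun g => ?_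
  rw [show (Fin.snoc default g : Fin 1 → A) = fun _ => g from funext fun i => by
    rw [Fin.eq_zero i]; exact Fin.snoc_last (α := fun _ => A) g default]

/-- With coefficient 0 the variable G can be dropped. Otherwise ℤ with all F equal to 0 separates
the formula from every atomic formula without G: there G = 0 is a solution and G = 1 is not. -/
theorem isProper_iff {n : ℕ} (t₁ t₂ : TermFG n) :
    IsProper t₁ t₂ ↔ termCoeff (.inr 0) t₁ - termCoeff (.inr 0) t₂ ≠ 0 := by
  rw [IsProper, not_iff_comm, not_not]
  constructor
  · intro h0
    obtain ⟨s, hs⟩ := exists_term_coeff fun i : Fin n =>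
      termCoeff (.inl i) t₁ - termCoeff (.inl i) t₂
    refine ⟨s, .func GroupFunc.zero Fin.elim0, fun A _ f g => ?_⟩
    rw [realize_bdEqual_iff, h0, zero_smul, add_zero, realize_eq_linForm s]
    simp only [hs]
    exact Iff.rfl
  · rintro ⟨s₁, s₂, h⟩
    have h1 := (h ℤ 0 0).1 ((realize_bdEqual_iff _ _ _ _).2 (by simp [linForm]))
    have h2 := (realize_bdEqual_iff _ _ _ _).1 ((h ℤ 0 1).2 h1)
    simpa [linForm] using h2

/-! ### The topology of the set of paths -/

theorem exists_cylinder_subset {V : Set (ℕ → ℕ)} (hV : IsOpen V) {x : ℕ → ℕ} (hx : x ∈ V) :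
    ∃ K, ∀ y : ℕ → ℕ, (∀ i < K, y i = x i) → y ∈ V := by
  obtain ⟨_, ⟨z, K, rfl⟩, hxz, hsub⟩ :=
    (PiNat.isTopologicalBasis_cylinders (fun _ : ℕ => ℕ)).mem_nhds_iff.1 (hV.mem_nhds hx)
  exact ⟨K, fun y hy => hsub fun i hi => (hy i hi).trans (hxz i hi)⟩

theorem isOpen_agree (x : ℕ → ℕ) (K : ℕ) : IsOpen {y : ℕ → ℕ | ∀ i < K, y i = x i} :=
  PiNat.isOpen_cylinder (fun _ : ℕ => ℕ) x K

theorem exists_agree_subset {T : Set (List ℕ)} {V : Set (Paths T)} (hV : IsOpen V) {P : Paths T}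
    (hP : P ∈ V) : ∃ K, ∀ Q : Paths T, (∀ i < K, Q.1 i = P.1 i) → Q ∈ V := by
  obtain ⟨W, hW, rfl⟩ := isOpen_induced_iff.1 hV
  obtain ⟨K, hK⟩ := exists_cylinder_subset hW hP
  exact ⟨K, fun Q hQ => hK Q.1 hQ⟩

theorem isClosed_setOf_path (T : Set (List ℕ)) :
    IsClosed {P : ℕ → ℕ | ∀ k, (List.range k).map P ∈ T} := by
  rw [Set.ofPred_forall]
  refine isClosed_iInter fun k => ⟨?_⟩
  refine isOpen_iff_mem_nhds.2 fun P hP => ?_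
  filter_upwards [(isOpen_agree P k).mem_nhds fun _ _ => rfl] with Q hQ
  rwa [Set.mem_compl_iff, Set.mem_ofPred_eq,
    List.map_congr_left fun i hi => hQ i (List.mem_range.1 hi)]

theorem finite_level {T : Set (List ℕ)} (hpre : ∀ σ τ : List ℕ, σ <+: τ → τ ∈ T → σ ∈ T)
    (hfin : ∀ σ ∈ T, {m : ℕ | σ ++ [m] ∈ T}.Finite) (k : ℕ) :
    {σ ∈ T | σ.length = k}.Finite := by
  induction k with
  | zero => exact (Set.finite_singleton []).subset fun σ hσ => List.length_eq_zero_iff.1 hσ.2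
  | succ k ih =>
    refine (ih.biUnion fun σ hσ => (hfin σ hσ.1).image fun m => σ ++ [m]).subset ?_
    rintro τ ⟨hτ, hlen⟩
    obtain ⟨σ, m, rfl⟩ := τ.eq_nil_or_concat'.resolve_left (by rintro rfl; simp at hlen)
    simp only [Set.mem_iUnion]
    exact ⟨σ, ⟨hpre _ _ (List.prefix_append _ _) hτ, by simpa using hlen⟩, m, hτ, rfl⟩

theorem compactSpace_paths {T : Set (List ℕ)}
    (hpre : ∀ σ τ : List ℕ, σ <+: τ → τ ∈ T → σ ∈ T)
    (hfin : ∀ σ ∈ T, {m : ℕ | σ ++ [m] ∈ T}.Finite) : CompactSpace (Paths T) := by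
  refine isCompact_iff_compactSpace.1 ?_
  refine IsCompact.of_isClosed_subset
    -- The k-th entry of a path is the last entry of a node of length k + 1, and there are finitely
    -- many such nodes. So the paths form a closed subset of a product of finite sets.
    (isCompact_univ_pi (s := fun k => (fun σ : List ℕ => σ.getD k 0) '' {σ ∈ T | σ.length = k + 1})
      fun k => ((finite_level hpre hfin (k + 1)).image _).isCompact)
    (isClosed_setOf_path T) fun P hP k _ => ?_
  exact ⟨(List.range (k + 1)).map P, ⟨hP (k + 1), by simp⟩, by simp [List.getD]⟩

/-! ### Tuples of paths as oracles -/

section Join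

variable {T : Set (List ℕ)} {n : ℕ}

theorem joinOracle_pair (f : Fin n → Paths T) (i : Fin n) (k : ℕ) :
    joinOracle f (Nat.pair i k) = (f i).1 k := by
  simp [joinOracle]

theorem continuous_joinOracle : Continuous (joinOracle : (Fin n → Paths T) → ℕ → ℕ) := by
  refine continuous_pi fun m => ?_
  unfold joinOracle
  by_cases h : (Nat.unpair m).1 < n
  · simp only [h, dite_true]
    exact (continuous_apply _).comp (continuous_subtype_val.comp (continuous_apply _))
  · simp only [h, dite_false]
    exact continuous_const

theorem joinOracle_injective :
    Function.Injective (joinOracle : (Fin n → Paths T) → ℕ → ℕ) := by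
  intro f g h
  funext i
  refine Subtype.ext (funext fun k => ?_)
  rw [← joinOracle_pair, h, joinOracle_pair]

/-- A continuous injection from a compact space into a Hausdorff space is an embedding. So
neighbourhoods of a tuple can be described by finitely many values of its join, which is what a
functional can inspect. -/
theorem exists_joinOracle_agree_subset [CompactSpace (Paths T)] {V : Set (Fin n → Paths T)}
    (hV : IsOpen V) {f : Fin n → Paths T} (hf : f ∈ V) :
    ∃ K, ∀ g : Fin n → Paths T, (∀ i < K, joinOracle g i = joinOracle f i) → g ∈ V := by
  have hemb : Topology.IsClosedEmbedding (joinOracle : (Fin n → Paths T) → ℕ → ℕ) :=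
    continuous_joinOracle.isClosedEmbedding joinOracle_injective
  obtain ⟨W, hW, rfl⟩ := hemb.isInducing.isOpen_iff.1 hV
  obtain ⟨K, hK⟩ := exists_cylinder_subset hW hf
  exact ⟨K, fun g hg => hK _ hg⟩

end Join

/-! ### Locally constant choices of computable paths -/

/-- A set of oracles which a Turing functional can use for a definition by cases. -/
def IsBranchable (C : Set (ℕ → ℕ)) : Prop :=
  ∀ f g : (ℕ → ℕ) → ℕ → ℕ, IsTuringFunctional (fun X m => Part.some (f X m)) →
    IsTuringFunctional (fun X m => Part.some (g X m)) →
    ∃ h : (ℕ → ℕ) → ℕ → ℕ, IsTuringFunctional (fun X m => Part.some (h X m)) ∧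
      (∀ X ∈ C, h X = f X) ∧ ∀ X ∉ C, h X = g X

theorem isBranchable_agree (Z : ℕ → ℕ) (K : ℕ) : IsBranchable {X | ∀ i < K, X i = Z i} := by
  induction K with
  | zero => exact fun f g hf hg => ⟨f, hf, fun _ _ => rfl, fun X hX => absurd (by simp) hX⟩
  | succ K ih =>
    intro f g hf hg
    -- The test at K is nested inside the tests below K; failing any of them leads to g.
    obtain ⟨h, hh, h1, h2⟩ := ih _ _ (hf.ite_oracle hg K (Z K)) hg
    refine ⟨h, hh, fun X hX => ?_, fun X hX => ?_⟩
    · rw [h1 X fun i hi => hX i (by omega)]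
      simp [hX K (by omega)]
    · by_cases hX' : ∀ i < K, X i = Z i
      · rw [h1 X hX']
        have : X K ≠ Z K := by
          intro hK
          refine hX fun i hi => ?_
          rcases Nat.lt_succ_iff_lt_or_eq.1 hi with h | rfl
          · exact hX' i h
          · exact hK
        simp [this]
      · exact h2 X hX'

theorem IsBranchable.union {C D : Set (ℕ → ℕ)} (hC : IsBranchable C) (hD : IsBranchable D) :
    IsBranchable (C ∪ D) := by
  intro f g hf hg
  obtain ⟨h, hh, h1, h2⟩ := hD f g hf hg
  obtain ⟨h', hh', h1', h2'⟩ := hC f h hf hh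
  refine ⟨h', hh', fun X hX => ?_, fun X hX => ?_⟩
  · by_cases hXC : X ∈ C
    · exact h1' X hXC
    · rw [h2' X hXC, h1 X (hX.resolve_left hXC)]
  · rw [h2' X fun h => hX (.inl h), h2 X fun h => hX (.inr h)]

/-- If on a compact set `C` every tuple has a neighbourhood on which some computable path is a good
choice, then good choices are made by a Turing functional. -/
theorem exists_functional_of_locally {T : Set (List ℕ)} {n : ℕ} [CompactSpace (Paths T)]
    (W : (Fin n → Paths T) → Paths T → Prop) {C : Set (Fin n → Paths T)} (hC : IsCompact C)
    (hW : ∀ f ∈ C, ∃ d : Paths T, Computable d.1 ∧ W f d ∧ IsOpen {f' | W f' d}) :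
    ∃ Ψ, IsTuringFunctional Ψ ∧ ∀ f ∈ C, ∃ g : Paths T, W f g ∧
      ∀ k, Ψ (joinOracle f) k = Part.some (g.1 k) := by
  suffices h : ∃ D : Set (ℕ → ℕ), IsBranchable D ∧ (∀ f ∈ C, joinOracle f ∈ D) ∧
      ∃ ψ : (ℕ → ℕ) → ℕ → ℕ, IsTuringFunctional (fun X m => Part.some (ψ X m)) ∧
        ∀ f, joinOracle f ∈ D → ∃ g : Paths T, W f g ∧ ψ (joinOracle f) = g.1 by
    obtain ⟨D, -, hCD, ψ, hψ, h⟩ := h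
    refine ⟨_, hψ, fun f hf => ?_⟩
    obtain ⟨g, hg, hg'⟩ := h f (hCD f hf)
    exact ⟨g, hg, fun k => by rw [hg']⟩
  -- Compactness as an induction principle. The functional is required to be correct on all of D,
  -- not only on C, so that two of them can be glued by testing membership in the first D.
  refine hC.induction_on (p := fun C => ∃ D : Set (ℕ → ℕ), IsBranchable D ∧
      (∀ f ∈ C, joinOracle f ∈ D) ∧
      ∃ ψ : (ℕ → ℕ) → ℕ → ℕ, IsTuringFunctional (fun X m => Part.some (ψ X m)) ∧
        ∀ f, joinOracle f ∈ D → ∃ g : Paths T, W f g ∧ ψ (joinOracle f) = g.1) ?_ ?_ ?_ ?_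
  · exact ⟨∅, fun f g _ hg => ⟨g, hg, fun X hX => hX.elim, fun _ _ => rfl⟩, fun f hf => hf.elim,
      fun _ _ => 0, IsTuringFunctional.zero, fun f hf => hf.elim⟩
  · rintro s t hst ⟨D, hD, hsub, h⟩
    exact ⟨D, hD, fun f hf => hsub f (hst hf), h⟩
  · rintro s t ⟨D, hD, hsD, ψ, hψ, h⟩ ⟨D', hD', htD, ψ', hψ', h'⟩
    obtain ⟨χ, hχ, h1, h2⟩ := hD ψ ψ' hψ hψ'
    refine ⟨D ∪ D', hD.union hD', ?_, χ, hχ, fun f hf => ?_⟩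
    · rintro f (hf | hf)
      · exact .inl (hsD f hf)
      · exact .inr (htD f hf)
    · by_cases hfD : joinOracle f ∈ D
      · rw [h1 _ hfD]
        exact h f hfD
      · rw [h2 _ hfD]
        exact h' f (hf.resolve_left hfD)
  · intro f hf
    obtain ⟨d, hd, hfd, hopen⟩ := hW f hf
    obtain ⟨K, hK⟩ := exists_joinOracle_agree_subset hopen hfd
    refine ⟨_, mem_nhdsWithin_of_mem_nhds ((continuous_joinOracle.isOpen_preimage _
      (isOpen_agree (joinOracle f) K)).mem_nhds fun _ _ => rfl), _,
      isBranchable_agree (joinOracle f) K, fun g hg => hg, fun _ => d.1,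
      IsTuringFunctional.of_computable hd, fun g hg => ⟨d, hK g hg, rfl⟩⟩

/-- Every node of a computable tree without dead ends lies on a computable path. -/
theorem exists_computable_path {T : Set (List ℕ)}
    (hpre : ∀ σ τ : List ℕ, σ <+: τ → τ ∈ T → σ ∈ T)
    (hcomp : ComputablePred fun σ : List ℕ => σ ∈ T)
    (hext : ∀ σ ∈ T, ∃ m, σ ++ [m] ∈ T) {σ : List ℕ} (hσ : σ ∈ T) :
    ∃ d : Paths T, Computable d.1 ∧ (List.range σ.length).map d.1 = σ := by
  obtain ⟨_, hdec⟩ := hcomp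
  have hstep : Partrec fun τ : List ℕ =>
      (Nat.rfind fun m => (Part.some (decide (τ ++ [m] ∈ T)) : Part Bool)).map
        fun m => τ ++ [m] := by
    have happ : Computable₂ fun (τ : List ℕ) (m : ℕ) => τ ++ [m] := Primrec.list_concat.to_comp
    exact (Partrec.rfind (hdec.comp happ).partrec.to₂).map happ
  have hstep' : ∀ τ ∈ T, ∃ m, τ ++ [m] ∈ T ∧ τ ++ [m] ∈
      (Nat.rfind fun m => (Part.some (decide (τ ++ [m] ∈ T)) : Part Bool)).map
        fun m => τ ++ [m] := by
    intro τ hτ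
    obtain ⟨m, hm⟩ := hext τ hτ
    obtain ⟨m, hm⟩ := Part.dom_iff_mem.1 (Nat.rfind_dom.2 ⟨m, by simpa using hm, fun _ => trivial⟩ :
      (Nat.rfind fun m => (Part.some (decide (τ ++ [m] ∈ T)) : Part Bool)).Dom)
    refine ⟨m, by simpa using Nat.rfind_spec hm, ?_⟩
    exact Part.mem_map _ hm
  let node : ℕ →. List ℕ := fun k => Nat.rec (Part.some σ) (fun _ ih => ih.bind fun τ =>
      (Nat.rfind fun m => (Part.some (decide (τ ++ [m] ∈ T)) : Part Bool)).map
        fun m => τ ++ [m]) k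
  have hnode : Partrec node :=
    Partrec.nat_rec Computable.id (Computable.const σ).partrec
      (hstep.comp (Computable.snd.comp Computable.snd)).to₂
  have hex : ∀ k, ∃ τ ∈ T, τ ∈ node k ∧ τ.length = σ.length + k := by
    intro k
    induction k with
    | zero => exact ⟨σ, hσ, Part.mem_some σ, rfl⟩
    | succ k ih =>
      obtain ⟨τ, hτ, hk, hlen⟩ := ih
      obtain ⟨m, hm, hm'⟩ := hstep' τ hτ
      exact ⟨_, hm, Part.mem_bind hk hm', by simp [hlen, add_assoc]⟩
  choose N hNT hNn hNlen using hex
  have hsucc : ∀ k, ∃ m, N (k + 1) = N k ++ [m] := by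
    intro k
    obtain ⟨m, hm, hm'⟩ := hstep' (N k) (hNT k)
    exact ⟨m, Part.mem_unique (hNn (k + 1)) (Part.mem_bind (hNn k) hm')⟩
  have hmono : ∀ k l, k ≤ l → N k <+: N l := by
    intro k l hkl
    induction hkl with
    | refl => exact List.prefix_rfl
    | step _ ih =>
      obtain ⟨m, hm⟩ := hsucc _
      rw [Nat.succ_eq_add_one, hm]
      exact ih.trans (List.prefix_append _ _)
  have hN0 : N 0 = σ := Part.mem_some_iff.1 (hNn 0)
  let d : ℕ → ℕ := fun k => (N (k + 1)).getD k 0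
  have hNd : ∀ j, (List.range (N j).length).map d = N j := by
    intro j
    refine List.ext_getElem (by simp) fun i h1 h2 => ?_
    -- Entry i is read from the node N (i + 1), which is long enough even when σ is empty.
    have hi : i < (N (i + 1)).length := by rw [hNlen]; omega
    simp only [List.getElem_map, List.getElem_range, d, List.getD_eq_getElem _ _ hi]
    rcases le_total (i + 1) j with h | h
    · exact (hmono _ _ h).getElem hi
    · exact ((hmono _ _ h).getElem h2).symm
  refine ⟨⟨d, fun k => ?_⟩, ?_, ?_⟩
  · refine hpre _ _ ?_ (hNT k)
    rw [← hNd k]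
    refine List.IsPrefix.map _ ?_
    rw [hNlen, add_comm, List.range_add]
    exact List.prefix_append _ _
  · have hN : Computable N := Partrec.of_eq_tot hnode hNn
    exact (Primrec.list_getD 0).to_comp.comp (hN.comp Computable.succ) Computable.id
  · have := hNd 0
    rwa [hN0] at this

/-! ### Skolem functions for conjunctive prenex formulas -/

theorem IsLinCongruence.split_one {n : ℕ} {A : Type*} [AddCommGroup A]
    {P : (Fin n ⊕ Fin 1 → A) → Prop} (hP : IsLinCongruence P) :
    IsLinCongruence₂ fun (f : Fin n → A) z => P (Sum.elim f fun _ => z) := by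
  obtain ⟨E, I, N, D, hN, hD, h⟩ := hP
  refine ⟨E.map fun c => (fun i => c (.inl i), c (.inr 0)),
    I.map fun c => (fun i => c (.inl i), c (.inr 0)), N,
    fun f z => D (Sum.elim f fun _ => z), hN, fun f w z y hz => ?_, fun f z => ?_⟩
  · convert hD _ (Sum.elim w fun _ => y) hz using 1
    ext (i | i) <;> simp
  · simp only [h, List.mem_map, forall_exists_index, and_imp, forall_apply_eq_imp_iff₂]
    simp [linForm]

/-! ### Topology and computable choice in the group of paths -/

namespace QESetting

variable {T : Set (List ℕ)} [AddCommGroup (Paths T)]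

theorem compactSpace (h : QESetting T) : CompactSpace (Paths T) := by
  obtain ⟨b, -, hb⟩ := h.computable_branching
  exact compactSpace_paths h.prefix_closed fun σ hσ => (hb σ hσ).1

/-- If there were finitely many paths, the positions at which they first show a difference from 0
would be bounded, and 0 would be isolated. -/
theorem infinite (h : QESetting T) : Infinite (Paths T) := by
  refine not_finite_iff_infinite.1 fun hfin => ?_
  have hex : ∀ Q : Paths T, ∃ i, Q ≠ 0 → Q.1 i ≠ (0 : Paths T).1 i := by
    intro Q
    by_cases hQ : Q = 0
    · exact ⟨0, fun h => absurd hQ h⟩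
    · obtain ⟨i, hi⟩ := Function.ne_iff.1 fun h => hQ (Subtype.ext h)
      exact ⟨i, fun _ => hi⟩
  choose i hi using hex
  obtain ⟨K, hK⟩ := (Set.finite_range i).bddAbove
  obtain ⟨Q, hQ, hag⟩ := h.no_isolated 0 (K + 1)
  exact hi Q hQ (hag _ (Nat.lt_succ_of_le (hK ⟨Q, rfl⟩)))

theorem int_torsion_free (h : QESetting T) (m : ℤ) (z : Paths T) (hm : m ≠ 0)
    (hz : m • z = 0) : z = 0 := by
  refine h.torsion_free m.natAbs z (Int.natAbs_ne_zero.2 hm) ?_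
  rw [← natCast_zsmul]
  rcases Int.natAbs_eq m with h | h
  · rwa [← h]
  · rw [h, neg_smul, neg_eq_zero] at hz
    exact hz

/-- By the use principle each value of P + Q depends on finitely many values of P and Q. -/
theorem continuousAdd (h : QESetting T) : ContinuousAdd (Paths T) := by
  obtain ⟨Φ, hΦ, hadd⟩ := h.computable_add
  refine ⟨Continuous.subtype_mk (continuous_pi fun k => ?_) _⟩
  refine continuous_discrete_rng.2 fun v => isOpen_iff_mem_nhds.2 ?_
  rintro ⟨P, Q⟩ hv
  obtain ⟨K, hK⟩ := hΦ.exists_use (joinOracle ![P, Q]) k v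
    (by rw [hadd]; exact Part.mem_some_iff.2 (Eq.symm hv))
  have hcont : Continuous fun x : Paths T × Paths T => joinOracle ![x.1, x.2] := by
    refine continuous_joinOracle.comp (continuous_pi fun i => ?_)
    fin_cases i
    · exact continuous_fst
    · exact continuous_snd
  filter_upwards [(hcont.isOpen_preimage _ (isOpen_agree (joinOracle ![P, Q]) K)).mem_nhds
    fun _ _ => rfl] with x hx
  have := hK _ hx
  rw [hadd, Part.mem_some_iff] at this
  exact this.symm

theorem isClosed_linForm_eq_zero (h : QESetting T) {α : Type*} [Fintype α] (c : α → ℤ) :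
    IsClosed {v : α → Paths T | linForm c v = 0} := by
  have := h.continuousAdd
  -- Moving the negative coefficients to the other side leaves natural multiples, so continuity of
  -- addition is enough.
  have heq : {v : α → Paths T | linForm c v = 0} =
      {v | ∑ x, (c x).toNat • v x = ∑ x, (-c x).toNat • v x} := by
    ext v
    rw [Set.mem_ofPred_eq, Set.mem_ofPred_eq, ← sub_eq_zero (b := ∑ x, (-c x).toNat • v x),
      ← Finset.sum_sub_distrib]
    refine iff_of_eq (congrArg (· = 0) (Finset.sum_congr rfl fun x _ => ?_))
    rw [← natCast_zsmul, ← natCast_zsmul, ← sub_smul, Int.toNat_sub_toNat_neg]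
  rw [heq]
  exact isClosed_eq (continuous_finsetSum _ fun x _ => (continuous_apply x).nsmul _)
    (continuous_finsetSum _ fun x _ => (continuous_apply x).nsmul _)

theorem isClopen_solvable (h : QESetting T) {n : ℕ} (c : Fin n → ℤ) {a : ℤ} (ha : a ≠ 0) :
    IsClopen {f : Fin n → Paths T | ∃ g, linForm c f + a • g = 0} := by
  obtain ⟨t, ht⟩ := exists_term_coeff (Sum.elim c fun _ : Fin 1 => a)
  obtain ⟨s, hs⟩ := exists_term_coeff fun _ : Fin n ⊕ Fin 1 => (0 : ℤ)
  have h1 := h.clopen n t s ((isProper_iff t s).2 (by simpa [ht, hs] using ha))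
  simpa only [realize_existsEq_iff, realize_bdEqual_iff, ht, hs, Sum.elim_inl, Sum.elim_inr,
    sub_zero] using h1

/-- The coset of f modulo multiples of N is open: each coordinate condition is a section of the
clopen set defined by ∃ G, -F₁ + F₂ - N G = 0. An invariant set is a union of such cosets. -/
theorem isOpen_of_congruence (h : QESetting T) {n : ℕ} {N : ℤ} (hN : N ≠ 0)
    {D : (Fin n → Paths T) → Prop} (hD : ∀ f w, D f → D (f + N • w)) : IsOpen {f | D f} := by
  refine isOpen_iff_mem_nhds.2 fun f hf => ?_
  have hcl := (h.isClopen_solvable ![-1, 1] (neg_ne_zero.2 hN)).isOpen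
  have hopen : ∀ i, IsOpen {f' : Fin n → Paths T | ∃ g, f' i - f i = N • g} := by
    intro i
    have hcont : Continuous fun f' : Fin n → Paths T => ![f i, f' i] := by
      refine continuous_pi fun j => ?_
      fin_cases j
      · exact continuous_const
      · exact continuous_apply i
    refine (congrArg IsOpen ?_).mp (hcl.preimage hcont)
    ext f'
    simp only [Set.mem_preimage, Set.mem_ofPred_eq, linForm, Fin.sum_univ_two]
    refine exists_congr fun g => ?_
    rw [← sub_eq_zero (b := N • g)]
    simp [sub_eq_add_neg, add_comm]
  have hall : {f' : Fin n → Paths T | ∀ i, ∃ g, f' i - f i = N • g} ∈ nhds f := by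
    rw [Set.ofPred_forall]
    exact (isOpen_iInter_of_finite hopen).mem_nhds 
      (Set.mem_iInter.2 fun i => ⟨0, by rw [sub_self, smul_zero]⟩)
  filter_upwards [hall] with f' hf'
  choose w hw using hf'
  have : f' = f + N • w := funext fun i => by
    rw [Pi.add_apply, Pi.smul_apply, ← hw i, add_sub_cancel]
  rw [this]
  exact hD f w hf

theorem exists_computable_mem (h : QESetting T) {W : Set (Paths T)} (hW : IsOpen W)
    (hne : W.Nonempty) : ∃ d ∈ W, Computable d.1 := by
  obtain ⟨P, hP⟩ := hne
  obtain ⟨K, hK⟩ := exists_agree_subset hW hP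
  have hext : ∀ σ ∈ T, ∃ m, σ ++ [m] ∈ T := by
    intro σ hσ
    obtain ⟨Q, hQ⟩ := h.extendible σ hσ
    refine ⟨Q.1 σ.length, ?_⟩
    have := Q.2 (σ.length + 1)
    rwa [List.range_succ, List.map_append, hQ] at this
  obtain ⟨d, hd, hpre⟩ := exists_computable_path h.prefix_closed h.computable_tree hext (P.2 K)
  refine ⟨d, hK d fun i hi => ?_, hd⟩
  rw [List.length_map, List.length_range] at hpre
  exact List.map_inj_left.1 hpre i (List.mem_range.2 hi)

/-- A computable choice of a solution of a congruence condition and finitely many inequations. -/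
theorem exists_functional_congruence (h : QESetting T) {n : ℕ} (I : List ((Fin n → ℤ) × ℤ))
    {N : ℤ} (hN : N ≠ 0) {D : (Fin n → Paths T) → Paths T → Prop}
    (hD : ∀ v w z y, D v z → D (v + N • w) (z + N • y)) :
    ∃ Ψ, IsTuringFunctional Ψ ∧ ∀ f, (∃ z, D f z) → ∃ g : Paths T,
      (D f g ∧ ∀ e ∈ I, e.2 ≠ 0 → linForm e.1 f + e.2 • g ≠ 0) ∧
      ∀ k, Ψ (joinOracle f) k = Part.some (g.1 k) := by
  have := h.compactSpace
  have := h.infinite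
  have hopenW : IsOpen {v : Fin (n + 1) → Paths T |
      D (fun i => v i.succ) (v 0) ∧
        ∀ e ∈ I, e.2 ≠ 0 → linForm e.1 (fun i => v i.succ) + e.2 • v 0 ≠ 0} := by
    rw [Set.ofPred_and]
    refine IsOpen.inter ?_ ?_
    · exact h.isOpen_of_congruence hN
        (D := fun v : Fin (n + 1) → Paths T => D (fun i => v i.succ) (v 0))
        fun v w hv => hD _ (fun i => w i.succ) _ (w 0) hv
    · have hfin : {e | e ∈ I ∧ e.2 ≠ 0}.Finite := (List.finite_toSet I).subset fun e he => he.1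
      have := hfin.isOpen_biInter (f := fun e => {v : Fin (n + 1) → Paths T |
        linForm (Fin.cons e.2 e.1 : Fin (n + 1) → ℤ) v = 0}ᶜ)
        fun e _ => (h.isClosed_linForm_eq_zero _).isOpen_compl
      refine (congrArg IsOpen ?_).mp this
      ext v
      simp [linForm, Fin.sum_univ_succ, add_comm]
  -- Translation by -w shows that the complement is invariant as well, hence open.
  have hcompact : IsCompact {f : Fin n → Paths T | ∃ z, D f z} := by
    refine IsClosed.isCompact ⟨?_⟩
    refine h.isOpen_of_congruence hN (D := fun f => ¬ ∃ z, D f z) ?_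
    rintro f w hf ⟨z, hz⟩
    refine hf ⟨z, ?_⟩
    simpa using hD _ (-w) _ 0 hz
  refine exists_functional_of_locally (fun f z => D f z ∧
    ∀ e ∈ I, e.2 ≠ 0 → linForm e.1 f + e.2 • z ≠ 0) hcompact fun f hf => ?_
  obtain ⟨z, hz⟩ := hf
  obtain ⟨y, hy⟩ := exists_congruent_avoiding h.int_torsion_free I hN f z
  have hc1 : Continuous fun g : Paths T => (Fin.cons g f : Fin (n + 1) → Paths T) :=
    continuous_pi fun i => by
      refine Fin.cases ?_ (fun i => ?_) i
      · exact continuous_id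
      · exact continuous_const
  obtain ⟨d, hd, hdc⟩ := h.exists_computable_mem (hopenW.preimage hc1)
    -- The admissible values at f form an open set, nonempty because z can be moved within its
    -- congruence class away from the inequations. A computable member d of it stays admissible for
    -- all tuples near f.
    ⟨z + N • y, by simpa using hD f 0 z y hz, hy⟩
  have hc2 : Continuous fun f' : Fin n → Paths T => (Fin.cons d f' : Fin (n + 1) → Paths T) :=
    continuous_pi fun i => by
      refine Fin.cases ?_ (fun i => ?_) i
      · exact continuous_const
      · exact continuous_apply i
  exact ⟨d, hdc, hd, hopenW.preimage hc2⟩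

end QESetting

/-- In a Skolem setting, conjunctive prenex formulas have computable Skolem functions. -/
theorem SkolemSetting.hasConjunctiveSkolemFunctions {T : Set (List ℕ)} [AddCommGroup (Paths T)]
    (h : SkolemSetting T) : HasConjunctiveSkolemFunctions T := by
  rintro n δ ⟨φ, hφ, hδφ⟩
  suffices hmain : ∃ Ψ, IsTuringFunctional Ψ ∧ ∀ f : Fin n → Paths T,
      (∃ g, δ.Realize f fun _ => g) → ∃ g : Paths T, δ.Realize f (fun _ => g) ∧
        ∀ k, Ψ (joinOracle f) k = Part.some (g.1 k) by
    obtain ⟨Ψ, hΨ, hmain⟩ := hmain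
    choose! S hS using hmain
    refine ⟨fun f => ⟨∃ g, δ.Realize f fun _ => g, fun _ => S f⟩, fun f hf => ?_, Ψ, hΨ, ?_⟩
    · obtain ⟨g, hg⟩ := BoundedFormula.realize_ex.1 hf
      rw [show (Fin.snoc default g : Fin 1 → Paths T) = fun _ => g from funext fun i => by
        rw [Fin.eq_zero i]; exact Fin.snoc_last (α := fun _ => Paths T) g default] at hg
      exact ⟨S f, ⟨⟨g, hg⟩, rfl⟩, (hS f ⟨g, hg⟩).1⟩
    · rintro f _ ⟨hf, rfl⟩
      exact (hS f hf).2
  have := h.infinite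
  obtain ⟨E, I, N, D, hN, hD, hEID⟩ :=
    (hφ.isLinCongruence (A := Paths T) h.int_torsion_free).split_one
  have hδ : ∀ f g, δ.Realize f (fun _ => g) ↔ (∀ e ∈ E, linForm e.1 f + e.2 • g = 0) ∧
      (∀ e ∈ I, linForm e.1 f + e.2 • g ≠ 0) ∧ D f g :=
    fun f g => (hδφ f g).trans (hEID f g)
  by_cases hE : ∃ e ∈ E, e.2 ≠ 0
  -- The chosen equation alone determines G, so its solution is the witness whenever δ is
  -- satisfiable at f. The Gödel number of the equation is a constant of the functional.
  · obtain ⟨⟨c, a⟩, he, ha⟩ := hE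
    obtain ⟨Θ, hΘ, hwit⟩ := h.computable_witness
    obtain ⟨t, ht⟩ := exists_term_coeff (Sum.elim c fun _ : Fin 1 => a)
    obtain ⟨s, hs⟩ := exists_term_coeff fun _ : Fin n ⊕ Fin 1 => (0 : ℤ)
    refine ⟨fun X k => Θ X (Nat.pair (eqCode t s) k), hΘ.comp_total
      (IsTuringFunctional.of_computable
        (Primrec₂.natPair.comp (Primrec.const (eqCode t s)) Primrec.id).to_comp), ?_⟩
    rintro f ⟨g, hg⟩
    refine ⟨g, hg, hwit n t s ((isProper_iff t s).2 (by simpa [ht, hs] using ha)) f g ?_⟩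
    rw [realize_bdEqual_iff]
    simpa [ht, hs] using ((hδ f g).1 hg).1 _ he
  -- The equations and the remaining inequations do not involve G, so they pass from the given
  -- solution z to the computed value g.
  · push Not at hE
    obtain ⟨Ψ, hΨ, hgood⟩ := h.exists_functional_congruence I hN hD
    refine ⟨Ψ, hΨ, ?_⟩
    rintro f ⟨z, hz⟩
    obtain ⟨hzE, hzI, hzD⟩ := (hδ f z).1 hz
    obtain ⟨g, ⟨hgD, hgI⟩, hg⟩ := hgood f ⟨z, hzD⟩
    refine ⟨g, (hδ f g).2 ⟨fun e he => ?_, fun e he => ?_, hgD⟩, hg⟩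
    · simpa [hE e he] using hzE e he
    · by_cases h0 : e.2 = 0
      · simpa [h0] using hzI e he
      · exact hgI e he h0

/-! ### Trees of compatible residues -/

/-- An indexing of the positions `j` of a sequence by pairs of a component `comp j` and a level
`lvl j`, with a prime for each component. -/
structure ResidueSystem where
  /-- The component of a position. -/
  comp : ℕ → ℕ
  /-- The level of a position. -/
  lvl : ℕ → ℕ
  /-- The position with given component and level. -/
  idx : ℕ → ℕ → ℕ
  /-- The prime of a component. -/
  q : ℕ → ℕ
  prime : ∀ c, (q c).Prime
  q_comp_idx : ∀ c l, q (comp (idx c l)) = q c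
  lvl_idx : ∀ c l, lvl (idx c l) = l
  idx_comp_lvl : ∀ j, idx (comp j) (lvl j) = j
  idx_comp_idx : ∀ c l l', idx (comp (idx c l)) l' = idx c l'
  idx_strictMono : ∀ c, StrictMono (idx c)
  idx_mono_left : ∀ c c' l, c ≤ c' → idx c l ≤ idx c' l
  comp_le : ∀ j, comp j ≤ q (comp j)
  computable_comp : Computable comp
  computable_lvl : Computable lvl
  computable_idx : Computable₂ idx
  computable_q : Computable q

/-- A prime power dividing `b ≠ 0` has exponent less than `|b|`. -/
theorem exponent_lt_of_pow_dvd {q : ℕ} (hq : q.Prime) {b : ℤ} (hb : b ≠ 0) {v : ℕ}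
    (h : (q : ℤ) ^ v ∣ b) : v < b.natAbs := by
  have h1 : q ^ v ∣ b.natAbs := by
    rw [← Int.natCast_dvd_natCast, Int.dvd_natAbs]; exact_mod_cast h
  exact (Nat.lt_pow_self hq.one_lt).trans_le (Nat.le_of_dvd (Int.natAbs_pos.2 hb) h1)

/-- The factor b absorbs fewer than |b| ≤ B factors q, so at least L of the L + B remain in x. -/
theorem pow_dvd_of_pow_add_dvd_mul {q : ℕ} (hq : q.Prime) {b x : ℤ} (hb : b ≠ 0) {B L : ℕ}
    (hB : b.natAbs ≤ B) (h : (q : ℤ) ^ (L + B) ∣ b * x) : (q : ℤ) ^ L ∣ x := by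
  have hq' : Prime (q : ℤ) := Nat.prime_iff_prime_int.1 hq
  have hfin : FiniteMultiplicity (q : ℤ) b :=
    Int.finiteMultiplicity_iff.2 ⟨by simpa using hq.ne_one, hb⟩
  obtain ⟨u, hu, hqu⟩ := hfin.exists_eq_pow_mul_and_not_dvd
  generalize multiplicity (q : ℤ) b = v at hu
  have hv : v < B := (exponent_lt_of_pow_dvd hq hb (Dvd.intro _ hu.symm)).trans_le hB
  rw [hu, show L + B = v + (L + (B - v)) by omega, pow_add, mul_assoc] at h
  have h1 := hq'.pow_dvd_of_dvd_mul_left _ hqu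
    (Int.dvd_of_mul_dvd_mul_left (pow_ne_zero _ hq'.ne_zero) h)
  exact (pow_dvd_pow _ (Nat.le_add_right _ _)).trans h1

namespace ResidueSystem

variable (R : ResidueSystem)

/-- The modulus at a position. -/
def modulus (j : ℕ) : ℕ := R.q (R.comp j) ^ (R.lvl j + 1)

/-- The modulus up to which the entry at a position is determined by the earlier ones. -/
def prevModulus (j : ℕ) : ℕ := R.q (R.comp j) ^ R.lvl j

/-- The preceding position in the same component. -/
def pred (j : ℕ) : ℕ := R.idx (R.comp j) (R.lvl j - 1)

/-- The tree of compatible sequences of residues. -/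
def tree : Set (List ℕ) :=
  {σ | ∀ j < σ.length, σ.getD j 0 < R.modulus j ∧
    σ.getD j 0 ≡ σ.getD (R.pred j) 0 [MOD R.prevModulus j]}

theorem pred_le (j : ℕ) : R.pred j ≤ j := by
  conv_rhs => rw [← R.idx_comp_lvl j]
  exact (R.idx_strictMono _).monotone (Nat.sub_le _ _)

theorem pred_lt {j : ℕ} (h : R.lvl j ≠ 0) : R.pred j < j := by
  conv_rhs => rw [← R.idx_comp_lvl j]
  exact R.idx_strictMono _ (by omega)

theorem modulus_pos (j : ℕ) : 0 < R.modulus j := pow_pos (R.prime _).pos _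

theorem modulus_idx (c l : ℕ) : R.modulus (R.idx c l) = R.q c ^ (l + 1) := by
  rw [modulus, R.q_comp_idx, R.lvl_idx]

theorem prevModulus_dvd_modulus (j : ℕ) : R.prevModulus j ∣ R.modulus j :=
  pow_dvd_pow _ (Nat.le_succ _)

theorem prevModulus_dvd_modulus_pred (j : ℕ) : R.prevModulus j ∣ R.modulus (R.pred j) := by
  rw [pred, modulus_idx, prevModulus]
  exact pow_dvd_pow _ (by omega)

theorem level_le (j : ℕ) : R.lvl j ≤ j := by
  conv_rhs => rw [← R.idx_comp_lvl j]
  exact (R.idx_strictMono _).le_apply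

theorem map_range_mem_tree (P : ℕ → ℕ) (k : ℕ) : (List.range k).map P ∈ R.tree ↔
    ∀ j < k, P j < R.modulus j ∧ P j ≡ P (R.pred j) [MOD R.prevModulus j] := by
  have h : ∀ j < k, ((List.range k).map P).getD j 0 = P j := fun j hj => by
    rw [List.getD_eq_getElem _ _ (by simpa using hj)]; simp
  simp only [tree, Set.mem_ofPred_eq, List.length_map, List.length_range]
  refine forall₂_congr fun j hj => ?_
  rw [h j hj, h _ ((R.pred_le j).trans_lt hj)]

theorem path_iff (P : ℕ → ℕ) : (∀ k, (List.range k).map P ∈ R.tree) ↔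
    ∀ j, P j < R.modulus j ∧ P j ≡ P (R.pred j) [MOD R.prevModulus j] := by
  simp only [map_range_mem_tree]
  exact ⟨fun h j => h (j + 1) j (Nat.lt_succ_self j), fun h k j _ => h j⟩

/-- The path of the residues of a sequence of integers. -/
def mkPath (F : ℕ → ℤ) (hF : ∀ j, F j ≡ F (R.pred j) [ZMOD R.prevModulus j]) :
    Paths R.tree :=
  ⟨fun j => (F j % R.modulus j).toNat, (R.path_iff _).2 fun j => by
    have hpos : ∀ j, (0 : ℤ) < R.modulus j := fun j => Int.natCast_pos.2 (R.modulus_pos j)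
    have hc : ∀ j, ((F j % R.modulus j).toNat : ℤ) = F j % R.modulus j := fun j =>
      Int.toNat_of_nonneg (Int.emod_nonneg _ (hpos j).ne')
    refine ⟨?_, ?_⟩
    · rw [← Int.ofNat_lt, hc]
      exact Int.emod_lt_of_pos _ (hpos j)
    · rw [← Int.natCast_modEq_iff, hc, hc]
      exact ((Int.mod_modEq _ _).of_dvd (Int.natCast_dvd_natCast.2
        (R.prevModulus_dvd_modulus j))).trans ((hF j).trans ((Int.mod_modEq _ _).of_dvd
          (Int.natCast_dvd_natCast.2 (R.prevModulus_dvd_modulus_pred j))).symm)⟩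

theorem path_lt (P : Paths R.tree) (j : ℕ) : P.1 j < R.modulus j := ((R.path_iff _).1 P.2 j).1

theorem path_modEq (P : Paths R.tree) (j : ℕ) :
    (P.1 j : ℤ) ≡ P.1 (R.pred j) [ZMOD R.prevModulus j] :=
  Int.natCast_modEq_iff.2 ((R.path_iff _).1 P.2 j).2

theorem coe_mkPath (F : ℕ → ℤ) (hF) (j : ℕ) : ((R.mkPath F hF).1 j : ℤ) = F j % R.modulus j :=
  Int.toNat_of_nonneg (Int.emod_nonneg _ (Int.natCast_pos.2 (R.modulus_pos j)).ne')

theorem path_ext {P Q : Paths R.tree} (h : ∀ j, (P.1 j : ℤ) ≡ Q.1 j [ZMOD R.modulus j]) :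
    P = Q := by
  refine Subtype.ext (funext fun j => ?_)
  have h1 := Int.natCast_modEq_iff.1 (h j)
  rwa [Nat.ModEq, Nat.mod_eq_of_lt (R.path_lt P j), Nat.mod_eq_of_lt (R.path_lt Q j)] at h1

instance : Zero (Paths R.tree) := ⟨R.mkPath 0 fun _ => rfl⟩
instance : Add (Paths R.tree) := ⟨fun P Q => R.mkPath (fun j => P.1 j + Q.1 j) fun j =>
  (R.path_modEq P j).add (R.path_modEq Q j)⟩
instance : Neg (Paths R.tree) := ⟨fun P => R.mkPath (fun j => -P.1 j) fun j =>
  (R.path_modEq P j).neg⟩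
instance : Sub (Paths R.tree) := ⟨fun P Q => R.mkPath (fun j => P.1 j - Q.1 j) fun j =>
  (R.path_modEq P j).sub (R.path_modEq Q j)⟩
instance : SMul ℕ (Paths R.tree) := ⟨fun m P => R.mkPath (fun j => m * P.1 j) fun j =>
  (R.path_modEq P j).mul_left _⟩
instance : SMul ℤ (Paths R.tree) := ⟨fun m P => R.mkPath (fun j => m * P.1 j) fun j =>
  (R.path_modEq P j).mul_left _⟩

/-- The residues of a path. -/
def residues (P : Paths R.tree) (j : ℕ) : ZMod (R.modulus j) := ((P.1 j : ℤ) : ZMod (R.modulus j))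

theorem residues_injective : Function.Injective R.residues := fun _ _ h =>
  R.path_ext fun j => (ZMod.intCast_eq_intCast_iff _ _ _).1 (congrFun h j)

theorem residues_mkPath (F : ℕ → ℤ) (hF) (j : ℕ) : R.residues (R.mkPath F hF) j = F j := by
  rw [residues, coe_mkPath, ZMod.intCast_mod]

instance instAddCommGroupPaths : AddCommGroup (Paths R.tree) :=
  R.residues_injective.addCommGroup _
    (funext fun j => (R.residues_mkPath _ _ j).trans (by simp))
    (fun P Q => funext fun j => (R.residues_mkPath _ _ j).trans (by simp [residues]))
    (fun P => funext fun j => (R.residues_mkPath _ _ j).trans (by simp [residues]))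
    (fun P Q => funext fun j => (R.residues_mkPath _ _ j).trans (by simp [residues]))
    (fun P m => funext fun j => (R.residues_mkPath _ _ j).trans (by simp [residues]))
    (fun P m => funext fun j => (R.residues_mkPath _ _ j).trans (by simp [residues]))

theorem add_apply (P Q : Paths R.tree) (j : ℕ) :
    (P + Q).1 j = (P.1 j + Q.1 j) % R.modulus j := by
  have := R.coe_mkPath (fun j => P.1 j + Q.1 j)
    (fun j => (R.path_modEq P j).add (R.path_modEq Q j)) j
  exact_mod_cast this

/-- The residue at a position, as a homomorphism. -/
def residueHom (j : ℕ) : Paths R.tree →+ ZMod (R.modulus j) where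
  toFun P := R.residues P j
  map_zero' := (R.residues_mkPath _ _ j).trans (by simp)
  map_add' P Q := (R.residues_mkPath _ _ j).trans (by simp [residues])

theorem residueHom_apply (j : ℕ) (P : Paths R.tree) : R.residueHom j P = ((P.1 j : ℤ) : ZMod _) :=
  rfl

theorem eq_zero_iff (P : Paths R.tree) : P = 0 ↔ ∀ j, (R.modulus j : ℤ) ∣ P.1 j := by
  rw [← R.residues_injective.eq_iff, funext_iff]
  refine forall_congr' fun j => ?_
  rw [← ZMod.intCast_zmod_eq_zero_iff_dvd]
  exact Eq.congr_right (map_zero (R.residueHom j))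

theorem linForm_modEq {α : Type*} [Fintype α] (c : α → ℤ) (f : α → Paths R.tree) (j : ℕ) :
    ((linForm c f).1 j : ℤ) ≡ ∑ i, c i * (f i).1 j [ZMOD R.modulus j] := by
  rw [← ZMod.intCast_eq_intCast_iff, ← R.residueHom_apply, linForm, map_sum]
  simp only [map_zsmul]
  simp [R.residueHom_apply]

theorem add_smul_eq_zero_iff (h : Paths R.tree) (b : ℤ) (g : Paths R.tree) :
    h + b • g = 0 ↔ ∀ j, (R.modulus j : ℤ) ∣ h.1 j + b * g.1 j := by
  rw [← R.residues_injective.eq_iff, funext_iff]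
  refine forall_congr' fun j => ?_
  rw [← ZMod.intCast_zmod_eq_zero_iff_dvd]
  refine Eq.congr ?_ (map_zero (R.residueHom j))
  refine (map_add (R.residueHom j) _ _).trans ?_
  rw [map_zsmul]
  simp [residueHom_apply]

/-! ### Components of paths -/

theorem pred_idx_succ (c l : ℕ) : R.pred (R.idx c (l + 1)) = R.idx c l := by
  rw [pred, R.lvl_idx, R.idx_comp_idx, Nat.add_sub_cancel]

theorem prevModulus_idx (c l : ℕ) : R.prevModulus (R.idx c l) = R.q c ^ l := by
  rw [prevModulus, R.q_comp_idx, R.lvl_idx]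

theorem path_idx_modEq (P : Paths R.tree) (c l m : ℕ) :
    (P.1 (R.idx c (l + m)) : ℤ) ≡ P.1 (R.idx c l) [ZMOD (R.q c : ℤ) ^ (l + 1)] := by
  induction m with
  | zero => rfl
  | succ m ih =>
    have h := R.path_modEq P (R.idx c (l + m + 1))
    rw [pred_idx_succ, prevModulus_idx] at h
    refine (h.of_dvd ?_).trans ih
    push_cast
    exact pow_dvd_pow _ (by omega)

theorem path_modEq_top (P : Paths R.tree) (j B : ℕ) :
    (P.1 (R.idx (R.comp j) (R.lvl j + B)) : ℤ) ≡ P.1 j [ZMOD R.modulus j] := by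
  have h := R.path_idx_modEq P (R.comp j) (R.lvl j) B
  rw [R.idx_comp_lvl] at h
  rw [modulus]
  exact_mod_cast h

/-- A system of residues on the levels of each component gives a path. -/
theorem mkPath_condition (F : ℕ → ℕ → ℤ)
    (hF : ∀ c l, F c (l + 1) ≡ F c l [ZMOD (R.q c : ℤ) ^ (l + 1)])
    (hcomp : ∀ c l l', F (R.comp (R.idx c l)) l' = F c l') (j : ℕ) :
    F (R.comp j) (R.lvl j) ≡ F (R.comp (R.pred j)) (R.lvl (R.pred j))
      [ZMOD R.prevModulus j] := by
  rw [pred, hcomp, R.lvl_idx, prevModulus]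
  rcases Nat.eq_zero_or_eq_succ_pred (R.lvl j) with h | h
  · rw [h]
  · rw [h]
    have := hF (R.comp j) (R.lvl j).pred
    simpa using this

/-! ### Linear equations -/

/-- A solution modulo a sufficiently high power determines the solution. -/
theorem solution_modEq {h g : Paths R.tree} {b : ℤ} (hb : b ≠ 0) {B : ℕ} (hB : b.natAbs ≤ B)
    (hg : h + b • g = 0) (j : ℕ) {x : ℤ}
    (hx : (R.modulus (R.idx (R.comp j) (R.lvl j + B)) : ℤ) ∣
      h.1 (R.idx (R.comp j) (R.lvl j + B)) + b * x) : x ≡ g.1 j [ZMOD R.modulus j] := by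
  refine Int.ModEq.trans ?_ (R.path_modEq_top g j B)
  have h1 := (R.add_smul_eq_zero_iff h b g).1 hg (R.idx (R.comp j) (R.lvl j + B))
  have h2 := dvd_sub h1 hx
  rw [add_sub_add_left_eq_sub, ← mul_sub, modulus_idx,
    show R.lvl j + B + 1 = R.lvl j + 1 + B by ring] at h2
  push_cast at h2
  refine Int.modEq_iff_dvd.2 ?_
  rw [modulus]
  push_cast
  exact pow_dvd_of_pow_add_dvd_mul (R.prime _) hb hB h2

theorem eq_zero_of_smul_eq_zero {b : ℤ} (hb : b ≠ 0) {z : Paths R.tree} (h : b • z = 0) :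
    z = 0 := by
  refine (R.eq_zero_iff z).2 fun j => ?_
  refine Int.modEq_zero_iff_dvd.1 (R.solution_modEq hb le_rfl ((zero_add _).trans h) j
    (x := 0) ?_).symm
  rw [mul_zero, add_zero]
  exact (R.eq_zero_iff 0).1 rfl _

/-- A linear equation in one unknown is solvable if it is solvable at one level of each of finitely
many components. -/
theorem exists_solution (h : Paths R.tree) {b : ℤ} (hb : b ≠ 0) {B : ℕ} (hB : b.natAbs ≤ B)
    (hsol : ∀ c ≤ B, ∃ x : ℤ, (R.modulus (R.idx c B) : ℤ) ∣ h.1 (R.idx c B) + b * x) :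
    ∃ g, h + b • g = 0 := by
  have hex : ∀ c L, ∃ x : ℤ, (R.q c : ℤ) ^ (L + 1) ∣ h.1 (R.idx c L) + b * x := by
    intro c L
    -- Different c may name the same component, as in the system of a single prime; c₀ is the name
    -- for which the bound `comp_le` is available.
    set c₀ := R.comp (R.idx c 0) with hc₀
    have hq : R.q c₀ = R.q c := R.q_comp_idx c 0
    obtain ⟨k, hk, hd⟩ : ∃ k ≤ L + 1, Int.gcd b ((R.q c : ℤ) ^ (L + 1)) = R.q c ^ k := by
      refine (Nat.dvd_prime_pow (R.prime c)).1 ?_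
      have := Int.gcd_dvd_right b ((R.q c : ℤ) ^ (L + 1))
      exact_mod_cast this
    have hkb : (R.q c : ℤ) ^ k ∣ b := by
      have := Int.gcd_dvd_left b ((R.q c : ℤ) ^ (L + 1))
      rw [hd] at this
      exact_mod_cast this
    have hkB : k ≤ B := (exponent_lt_of_pow_dvd (R.prime c) hb hkb).le.trans hB
    -- By Bézout, solvability modulo q ^ (L + 1) means that q ^ k, the gcd of b and this modulus,
    -- divides the constant. If k > 0 then q ≤ |b| ≤ B, so the component is among those tested;
    -- since k ≤ B, level B decides the divisibility.
    have hdvd : (R.q c : ℤ) ^ k ∣ h.1 (R.idx c L) := by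
      rcases Nat.eq_zero_or_pos k with rfl | hk0
      · simp
      have hqB : R.q c ≤ B := by
        have h1 : R.q c ∣ b.natAbs := Int.natCast_dvd.1 ((dvd_pow_self _ hk0.ne').trans hkb)
        exact (Nat.le_of_dvd (Int.natAbs_pos.2 hb) h1).trans hB
      obtain ⟨y, hy⟩ := hsol c₀ ((R.comp_le _).trans (hq.trans_le hqB))
      rw [R.idx_comp_idx, modulus_idx] at hy
      push_cast at hy
      have h1 : (R.q c : ℤ) ^ k ∣ h.1 (R.idx c B) :=
        (dvd_add_left (hkb.mul_right y)).1 ((pow_dvd_pow _ (by omega)).trans hy)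
      rcases le_total L B with hLB | hLB
      · have h2 := (R.path_idx_modEq h c L (B - L)).of_dvd (pow_dvd_pow _ hk)
        rw [Nat.add_sub_cancel' hLB] at h2
        exact h2.dvd_iff.1 h1
      · have h2 := (R.path_idx_modEq h c B (L - B)).of_dvd
          (pow_dvd_pow _ (hkB.trans (Nat.le_succ B)))
        rw [Nat.add_sub_cancel' hLB] at h2
        exact h2.dvd_iff.2 h1
    obtain ⟨u, w, huw⟩ := Int.gcd_dvd_iff.1
      (show Int.gcd b ((R.q c : ℤ) ^ (L + 1)) ∣ h.1 (R.idx c L) by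
        rw [hd]; exact_mod_cast hdvd)
    exact ⟨-u, w, by rw [huw]; ring⟩
  choose x hx using hex
  have hxc : ∀ c l, (R.q c : ℤ) ^ (l + 1) ∣
      h.1 (R.idx c l) + b * x (R.comp (R.idx c 0)) l := by
    intro c l
    have := hx (R.comp (R.idx c 0)) l
    rwa [R.q_comp_idx, R.idx_comp_idx] at this
  -- The chosen solutions need not be compatible. Taken B levels higher, they are, because division
  -- by b loses fewer than B factors.
  have hmod : ∀ c l, x (R.comp (R.idx c 0)) (l + 1 + B) ≡ x (R.comp (R.idx c 0)) (l + B)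
      [ZMOD (R.q c : ℤ) ^ (l + 1)] := by
    intro c l
    refine Int.modEq_iff_dvd.2 (pow_dvd_of_pow_add_dvd_mul (R.prime c) hb hB ?_)
    have h1 := (pow_dvd_pow _ (by omega)).trans (hxc c (l + 1 + B)) (a := (R.q c : ℤ) ^ (l + 1 + B))
    have h2 := hxc c (l + B)
    have h3 := Int.modEq_iff_dvd.1 (R.path_idx_modEq h c (l + B) 1)
    rw [show l + B + 1 = l + 1 + B by ring] at h2 h3
    have := dvd_add (dvd_sub h2 h1) (dvd_neg.2 h3)
    refine (congrArg (_ ∣ ·) ?_).mp this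
    ring
  refine ⟨R.mkPath _ (R.mkPath_condition (fun c l => x (R.comp (R.idx c 0)) (l + B)) hmod
    fun c l l' => by simp only [R.idx_comp_idx]), (R.add_smul_eq_zero_iff _ _ _).2 fun j => ?_⟩
  rw [coe_mkPath]
  have h1 := hxc (R.comp j) (R.lvl j + B)
  have h2 : (R.modulus j : ℤ) ∣ h.1 (R.idx (R.comp j) (R.lvl j + B)) +
      b * x (R.comp (R.idx (R.comp j) 0)) (R.lvl j + B) := by
    refine dvd_trans ?_ h1
    rw [modulus]
    push_cast
    exact pow_dvd_pow _ (by omega)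
  refine Int.modEq_zero_iff_dvd.1 (Int.ModEq.trans ?_ (Int.modEq_zero_iff_dvd.2 h2))
  exact (R.path_modEq_top h j B).symm.add ((Int.mod_modEq _ _).mul_left b)

/-! ### The tree of compatible residues -/

theorem append_mem_tree_iff (σ : List ℕ) (m : ℕ) : σ ++ [m] ∈ R.tree ↔ σ ∈ R.tree ∧
    m < R.modulus σ.length ∧
      m ≡ σ.getD (R.pred σ.length) 0 [MOD R.prevModulus σ.length] := by
  have h1 : ∀ j < σ.length, (σ ++ [m]).getD j 0 = σ.getD j 0 := fun j hj =>
    List.getD_append _ _ _ _ hj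
  have h2 : (σ ++ [m]).getD σ.length 0 = m := by simp [List.getD]
  have h3 : (m ≡ (σ ++ [m]).getD (R.pred σ.length) 0 [MOD R.prevModulus σ.length]) ↔
      m ≡ σ.getD (R.pred σ.length) 0 [MOD R.prevModulus σ.length] := by
    -- On level 0 the predecessor is the position itself, outside σ, but the congruence is modulo 1.
    by_cases h0 : R.lvl σ.length = 0
    · simp [prevModulus, h0, Nat.modEq_one]
    · rw [h1 _ (R.pred_lt h0)]
  simp only [tree, Set.mem_ofPred_eq, List.length_append, List.length_singleton,
    Nat.forall_lt_succ_right, h2, h3]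
  refine and_congr_left fun _ => forall₂_congr fun j hj => ?_
  rw [h1 j hj, h1 _ ((R.pred_le j).trans_lt hj)]

theorem tree_prefix_closed (σ τ : List ℕ) (h : σ <+: τ) (hτ : τ ∈ R.tree) : σ ∈ R.tree := by
  obtain ⟨ρ, rfl⟩ := h
  intro j hj
  have := hτ j (by rw [List.length_append]; omega)
  rwa [List.getD_append _ _ _ _ hj, List.getD_append _ _ _ _ ((R.pred_le j).trans_lt hj)] at this

theorem tree_extendible (σ : List ℕ) (hσ : σ ∈ R.tree) :
    ∃ P : Paths R.tree, (List.range σ.length).map P.1 = σ := by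
  -- Each component is continued beyond σ by repeating its last residue; a component that σ does not
  -- reach is constantly 0.
  obtain ⟨F, hF0, hF1⟩ : ∃ F : ℕ → ℕ → ℕ, (∀ c, F c 0 = σ.getD (R.idx c 0) 0) ∧ ∀ c l,
      F c (l + 1) = if R.idx c (l + 1) < σ.length then σ.getD (R.idx c (l + 1)) 0 else F c l :=
    ⟨fun c l => Nat.rec (σ.getD (R.idx c 0) 0) (fun l r =>
      if R.idx c (l + 1) < σ.length then σ.getD (R.idx c (l + 1)) 0 else r) l,
      fun _ => rfl, fun _ _ => rfl⟩
  have hval : ∀ c l, R.idx c l < σ.length → F c l = σ.getD (R.idx c l) 0 := by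
    intro c l hl
    cases l with
    | zero => exact hF0 c
    | succ l => rw [hF1, if_pos hl]
  have hmod : ∀ c l, ((F c (l + 1) : ℕ) : ℤ) ≡ ((F c l : ℕ) : ℤ) [ZMOD (R.q c : ℤ) ^ (l + 1)] := by
    intro c l
    rw [hF1]
    split_ifs with hl
    · rw [hval c l ((R.idx_strictMono c (Nat.lt_succ_self l)).trans hl)]
      have := (hσ _ hl).2
      rw [pred_idx_succ, prevModulus_idx] at this
      exact_mod_cast Int.natCast_modEq_iff.2 this
    · rfl
  have hcomp : ∀ c l l', F (R.comp (R.idx c l)) l' = F c l' := by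
    intro c l l'
    induction l' with
    | zero => simp only [hF0, R.idx_comp_idx]
    | succ l' ih => simp only [hF1, R.idx_comp_idx, ih]
  refine ⟨R.mkPath _ (R.mkPath_condition (fun c l => (F c l : ℤ)) hmod
    fun c l l' => congrArg _ (hcomp c l l')), ?_⟩
  refine List.ext_getElem (by simp) fun j h1 h2 => ?_
  rw [List.getElem_map, List.getElem_range]
  have h3 : F (R.comp j) (R.lvl j) = σ.getD j 0 := by
    rw [hval _ _ (by rwa [R.idx_comp_lvl]), R.idx_comp_lvl]
  have h4 := R.coe_mkPath _ (R.mkPath_condition (fun c l => (F c l : ℤ)) hmod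
    fun c l l' => congrArg _ (hcomp c l l')) j
  rw [h3] at h4
  norm_cast at h4
  rw [h4, Nat.mod_eq_of_lt (hσ j h2).1, List.getD_eq_getElem _ _ h2]

theorem tree_branching (σ : List ℕ) (hσ : σ ∈ R.tree) : {m : ℕ | σ ++ [m] ∈ R.tree}.Finite ∧
    {m : ℕ | σ ++ [m] ∈ R.tree}.ncard = R.q (R.comp σ.length) := by
  have hpos : 0 < R.prevModulus σ.length := pow_pos (R.prime _).pos _
  have hmul : R.modulus σ.length = R.prevModulus σ.length * R.q (R.comp σ.length) := pow_succ _ _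
  -- The successors are the lifts of a residue modulo q ^ l to residues modulo q ^ (l + 1).
  have heq : {m : ℕ | σ ++ [m] ∈ R.tree} = (fun t => σ.getD (R.pred σ.length) 0 %
      R.prevModulus σ.length + R.prevModulus σ.length * t) ''
        (Finset.range (R.q (R.comp σ.length)) : Set ℕ) := by
    ext m
    simp only [append_mem_tree_iff, hσ, true_and, Set.mem_ofPred_eq, Set.mem_image,
      Finset.mem_coe, Finset.mem_range]
    constructor
    · rintro ⟨h1, h2⟩
      refine ⟨m / R.prevModulus σ.length, Nat.div_lt_of_lt_mul (hmul ▸ h1), ?_⟩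
      rw [← h2]
      exact Nat.mod_add_div _ _
    · rintro ⟨t, ht, rfl⟩
      refine ⟨?_, ?_⟩
      · rw [hmul]
        calc _ < R.prevModulus σ.length + R.prevModulus σ.length * t :=
              Nat.add_lt_add_right (Nat.mod_lt _ hpos) _
          _ = R.prevModulus σ.length * (t + 1) := by ring
          _ ≤ _ := Nat.mul_le_mul_left _ ht
      · rw [Nat.ModEq, Nat.add_mul_mod_self_left, Nat.mod_mod]
  rw [heq]
  refine ⟨(Finset.finite_toSet _).image _, ?_⟩
  rw [Set.ncard_image_of_injective, Set.ncard_coe_finset, Finset.card_range]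
  intro t t' h
  exact Nat.eq_of_mul_eq_mul_left hpos (Nat.add_left_cancel h)

theorem tree_no_isolated (P : Paths R.tree) (k : ℕ) :
    ∃ Q : Paths R.tree, Q ≠ P ∧ ∀ i < k, Q.1 i = P.1 i := by
  -- The path with value q ^ k in the component of q vanishes at every position below k, since
  -- levels do not exceed positions, but it is nonzero on level k.
  have hcond := R.mkPath_condition (fun c _ => (R.q c : ℤ) ^ k) (fun _ _ => rfl)
    fun c l _ => by simp only [R.q_comp_idx]
  refine ⟨P + R.mkPath _ hcond, ?_, fun i hi => ?_⟩
  · intro h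
    have h1 := (R.eq_zero_iff _).1 (add_eq_left.1 h) (R.idx 0 k)
    rw [coe_mkPath, modulus_idx, R.q_comp_idx] at h1
    have h2 := (Int.mod_modEq _ _).dvd_iff.1 h1
    have h3 : R.q 0 ^ (k + 1) ∣ R.q 0 ^ k := by exact_mod_cast h2
    have := (Nat.pow_dvd_pow_iff_le_right (R.prime 0).one_lt).1 h3
    omega
  · rw [add_apply]
    have h1 : (R.modulus i : ℤ) ∣ (R.mkPath _ hcond).1 i := by
      rw [coe_mkPath, (Int.mod_modEq _ _).dvd_iff, modulus]
      push_cast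
      exact pow_dvd_pow _ (by have := R.level_le i; omega)
    obtain ⟨c, hc⟩ := Int.natCast_dvd_natCast.1 h1
    rw [hc, Nat.add_mul_mod_self_left, Nat.mod_eq_of_lt (R.path_lt P i)]

end ResidueSystem

/-! ### Bounded quantifiers and search -/

theorem computable_forall_lt {α : Type*} [Primcodable α] {p : α → ℕ → Bool} {n : α → ℕ}
    (hp : Computable₂ p) (hn : Computable n) :
    Computable fun a => decide (∀ j < n a, p a j = true) := by
  have h : Computable fun a => Nat.rec (motive := fun _ => Bool) true
      (fun j r => r && p a j) (n a) := by
    refine Computable.nat_rec (h := fun a jr => jr.2 && p a jr.1) hn (Computable.const true) ?_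
    exact Primrec.and.to_comp.comp (Computable.snd.comp Computable.snd)
      (hp.comp Computable.fst (Computable.fst.comp Computable.snd))
  refine h.of_eq fun a => ?_
  induction n a with
  | zero => simp
  | succ k ih =>
    simp only [ih, Nat.forall_lt_succ_right]
    rw [Bool.eq_iff_iff]
    simp

theorem computable_exists_lt {α : Type*} [Primcodable α] {p : α → ℕ → Bool} {n : α → ℕ}
    (hp : Computable₂ p) (hn : Computable n) :
    Computable fun a => decide (∃ j < n a, p a j = true) := by
  have hp' : Computable₂ fun a j => !p a j := Primrec.not.to_comp.comp hp
  refine (Primrec.not.to_comp.comp (computable_forall_lt hp' hn)).of_eq fun a => ?_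
  rw [Bool.eq_iff_iff]
  simp

/-! ### Evaluation of coded terms -/

/-- One step of the evaluation of a term in Polish notation. The stack holds integers, each given
as a difference of two natural numbers. -/
def polishStep (env : ℕ → ℕ) (s : ℕ) (st : List (ℕ × ℕ)) : List (ℕ × ℕ) :=
  if s = 1 then (0, 0) :: st
  else if s = 3 then (st.headI.2, st.headI.1) :: st.tail
  else if s = 5 then
    (st.headI.1 + st.tail.headI.1, st.headI.2 + st.tail.headI.2) :: st.tail.tail
  else (env s, 0) :: st

/-- The symbols of a term, as numbers. -/
def termSymbols {n : ℕ} (t : TermFG n) : List ℕ := t.listEncode.map Encodable.encode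

theorem encode_list_map {α : Type*} [Encodable α] (l : List α) :
    Encodable.encode (l.map Encodable.encode) = Encodable.encode l := by
  induction l with
  | nil => rfl
  | cons a l ih => simp [Encodable.encode_list_cons, ih]

theorem encode_term {n : ℕ} (t : TermFG n) :
    Encodable.encode t = Encodable.encode (termSymbols t) := (encode_list_map _).symm

/-- The trailing word w makes the induction go through: reading from the right, the arguments of a
symbol are already on the stack when it is reached. Under the encoding of sums Fᵢ has the number 4
i, G has 2, and the function symbols have 1, 3 and 5. -/
theorem polish_termSymbols {n : ℕ} (env : ℕ → ℕ) (t : TermFG n) :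
    ∃ a b : ℕ, (∀ w st, (termSymbols t ++ w).foldr (polishStep env) st =
        (a, b) :: w.foldr (polishStep env) st) ∧
      (a : ℤ) - b = ∑ i : Fin n, termCoeff (.inl i) t * env (4 * i) +
        termCoeff (.inr 0) t * env 2 := by
  induction t with
  | var x =>
    have h4 : ∀ i : Fin n, 4 * (i : ℕ) ≠ 1 ∧ 4 * (i : ℕ) ≠ 3 ∧ 4 * (i : ℕ) ≠ 5 := fun i => by omega
    rcases x with i | i
    · refine ⟨env (4 * i), 0, fun w st => ?_, ?_⟩
      · have : Encodable.encode (Sum.inl (Sum.inl i) :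
            (Fin n ⊕ Fin 1) ⊕ (Σ i, groupLang.Functions i)) = 4 * i := by
          rw [Encodable.encode_inl, Encodable.encode_inl, show Encodable.encode i = (i : ℕ) from rfl]
          ring
        simp [termSymbols, Term.listEncode, this, polishStep, h4]
      · simp [termCoeff]
    · refine ⟨env 2, 0, fun w st => ?_, ?_⟩
      · have : Encodable.encode (Sum.inl (Sum.inr i) :
            (Fin n ⊕ Fin 1) ⊕ (Σ i, groupLang.Functions i)) = 2 := by
          rw [Fin.eq_zero i]; rfl
        simp [termSymbols, Term.listEncode, this, polishStep]
      · simp [termCoeff, Fin.eq_zero i]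
  | func F ts ih =>
    cases F with
    | zero =>
      refine ⟨0, 0, fun w st => ?_, ?_⟩
      · have : Encodable.encode (Sum.inr ⟨0, GroupFunc.zero⟩ :
            (Fin n ⊕ Fin 1) ⊕ (Σ i, groupLang.Functions i)) = 1 := rfl
        simp [termSymbols, Term.listEncode, this, polishStep]
      · simp [termCoeff]
    | neg =>
      obtain ⟨a, b, h, hab⟩ := ih 0
      refine ⟨b, a, fun w st => ?_, ?_⟩
      · have : Encodable.encode (Sum.inr ⟨1, GroupFunc.neg⟩ :
            (Fin n ⊕ Fin 1) ⊕ (Σ i, groupLang.Functions i)) = 3 := rfl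
        have hs : termSymbols (Term.func GroupFunc.neg ts) = 3 :: termSymbols (ts 0) := by
          simp [termSymbols, Term.listEncode, this, List.finRange_succ]
        rw [hs, List.cons_append, List.foldr_cons, h]
        simp [polishStep]
      · rw [← neg_sub, hab]
        simp [termCoeff]
        ring
    | add =>
      obtain ⟨a, b, h, hab⟩ := ih 0
      obtain ⟨a', b', h', hab'⟩ := ih 1
      refine ⟨a + a', b + b', fun w st => ?_, ?_⟩
      · have : Encodable.encode (Sum.inr ⟨2, GroupFunc.add⟩ :
            (Fin n ⊕ Fin 1) ⊕ (Σ i, groupLang.Functions i)) = 5 := rfl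
        have hs : termSymbols (Term.func GroupFunc.add ts) =
            5 :: (termSymbols (ts 0) ++ termSymbols (ts 1)) := by
          simp [termSymbols, Term.listEncode, this, List.finRange_succ]
        rw [hs, List.cons_append, List.foldr_cons, List.append_assoc, h, h']
        simp [polishStep]
      · push_cast
        rw [add_sub_add_comm, hab, hab']
        simp only [termCoeff, add_mul, Finset.sum_add_distrib]
        ring

/-- The values of the variables that are read off from position `j` of an initial segment `L` of
the join of a tuple, where `G` gets the value `x`. -/
def segmentEnv (L : List ℕ) (j x s : ℕ) : ℕ :=
  if s = 2 then x else L.getD (Nat.pair (s / 4) j) 0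

/-- The value of the term with code `e`. -/
def evalCode (L : List ℕ) (j x e : ℕ) : ℕ × ℕ :=
  ((((Encodable.decode (α := List ℕ) e).getD []).foldr (polishStep (segmentEnv L j x)) []).headI)

/-- The two sides of the equation between the terms with codes `e.1` and `e.2`. -/
def evalSides (L : List ℕ) (j x : ℕ) (e : ℕ × ℕ) : ℕ × ℕ :=
  ((evalCode L j x e.1).1 + (evalCode L j x e.2).2,
    (evalCode L j x e.1).2 + (evalCode L j x e.2).1)

theorem evalSides_sub {n : ℕ} (L : List ℕ) (j x : ℕ) (t₁ t₂ : TermFG n) :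
    ((evalSides L j x (Encodable.encode t₁, Encodable.encode t₂)).1 : ℤ) -
      (evalSides L j x (Encodable.encode t₁, Encodable.encode t₂)).2 =
      ∑ i : Fin n, (termCoeff (.inl i) t₁ - termCoeff (.inl i) t₂) * L.getD (Nat.pair i j) 0 +
        (termCoeff (.inr 0) t₁ - termCoeff (.inr 0) t₂) * x := by
  have h : ∀ t : TermFG n, ((evalCode L j x (Encodable.encode t)).1 : ℤ) -
      (evalCode L j x (Encodable.encode t)).2 =
      ∑ i : Fin n, termCoeff (.inl i) t * L.getD (Nat.pair i j) 0 +
        termCoeff (.inr 0) t * x := by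
    intro t
    obtain ⟨a, b, h, hab⟩ := polish_termSymbols (segmentEnv L j x) t
    have h1 := h [] []
    rw [List.append_nil] at h1
    rw [evalCode, encode_term, Encodable.encodek, Option.getD_some, h1, List.headI_cons, hab]
    have h4 : ∀ i : Fin n, segmentEnv L j x (4 * i) = L.getD (Nat.pair i j) 0 := by
      intro i
      rw [segmentEnv, if_neg (by omega), Nat.mul_div_cancel_left _ (by norm_num)]
    simp only [h4]
    simp [segmentEnv]
  simp only [evalSides]
  push_cast
  have h1 := h t₁
  have h2 := h t₂
  simp only [sub_mul, Finset.sum_sub_distrib]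
  linarith

section Primrec

variable {α : Type*} [Primcodable α]

theorem primrec_evalCode {L : α → List ℕ} {j x e : α → ℕ} (hL : Primrec L) (hj : Primrec j)
    (hx : Primrec x) (he : Primrec e) : Primrec fun a => evalCode (L a) (j a) (x a) (e a) := by
  refine Primrec.list_headI.comp (Primrec.list_foldr
    (h := fun a p => polishStep (segmentEnv (L a) (j a) (x a)) p.1 p.2) (Primrec.option_getD.comp
    (Primrec.decode.comp he) (Primrec.const [])) (Primrec.const []) ?_)
  have hs : Primrec fun p : α × ℕ × List (ℕ × ℕ) => p.2.1 := Primrec.fst.comp Primrec.snd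
  have hst : Primrec fun p : α × ℕ × List (ℕ × ℕ) => p.2.2 := Primrec.snd.comp Primrec.snd
  have hh := Primrec.list_headI.comp hst
  have ht := Primrec.list_tail.comp hst
  have hth := Primrec.list_headI.comp ht
  have heq : ∀ m : ℕ, PrimrecPred fun p : α × ℕ × List (ℕ × ℕ) => p.2.1 = m := fun m =>
    Primrec.eq.comp hs (Primrec.const m)
  refine Primrec.ite (heq 1) (Primrec.list_cons.comp (Primrec.const _) hst) ?_
  refine Primrec.ite (heq 3) (Primrec.list_cons.comp
    (Primrec.pair (Primrec.snd.comp hh) (Primrec.fst.comp hh)) ht) ?_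
  refine Primrec.ite (heq 5) (Primrec.list_cons.comp (Primrec.pair
    (Primrec.nat_add.comp (Primrec.fst.comp hh) (Primrec.fst.comp hth))
    (Primrec.nat_add.comp (Primrec.snd.comp hh) (Primrec.snd.comp hth)))
    (Primrec.list_tail.comp ht)) ?_
  refine Primrec.list_cons.comp (Primrec.pair ?_ (Primrec.const 0)) hst
  refine Primrec.ite (heq 2) (hx.comp Primrec.fst) ?_
  exact (Primrec.list_getD 0).comp (hL.comp Primrec.fst)
    (Primrec₂.natPair.comp (Primrec.nat_div.comp hs (Primrec.const 4)) (hj.comp Primrec.fst))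

theorem primrec_evalSides : Primrec fun a : List ℕ × ℕ × ℕ × ℕ × ℕ =>
    evalSides a.1 a.2.1 a.2.2.1 a.2.2.2 := by
  have hL : Primrec fun a : List ℕ × ℕ × ℕ × ℕ × ℕ => a.1 := Primrec.fst
  have hj : Primrec fun a : List ℕ × ℕ × ℕ × ℕ × ℕ => a.2.1 := Primrec.fst.comp Primrec.snd
  have hx : Primrec fun a : List ℕ × ℕ × ℕ × ℕ × ℕ => a.2.2.1 :=
    Primrec.fst.comp (Primrec.snd.comp Primrec.snd)
  have he : Primrec fun a : List ℕ × ℕ × ℕ × ℕ × ℕ => a.2.2.2 :=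
    Primrec.snd.comp (Primrec.snd.comp Primrec.snd)
  have h1 := primrec_evalCode hL hj hx (Primrec.fst.comp he)
  have h2 := primrec_evalCode hL hj hx (Primrec.snd.comp he)
  exact Primrec.pair
    (Primrec.nat_add.comp (Primrec.fst.comp h1) (Primrec.snd.comp h2))
    (Primrec.nat_add.comp (Primrec.snd.comp h1) (Primrec.fst.comp h2))

/-- Whether `x` solves the equation with codes `e` modulo `M` at position `j`. -/
def solvesMod (L : List ℕ) (j M : ℕ) (e : ℕ × ℕ) (x : ℕ) : Bool :=
  decide ((evalSides L j x e).1 % M = (evalSides L j x e).2 % M)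

theorem computable_solvesMod {L : α → List ℕ} {j M : α → ℕ} {e : α → ℕ × ℕ}
    (hL : Computable L) (hj : Computable j) (hM : Computable M) (he : Computable e) :
    Computable₂ fun a x => solvesMod (L a) (j a) (M a) (e a) x := by
  have h := primrec_evalSides.to_comp.comp ((hL.comp Computable.fst).pair
    ((hj.comp Computable.fst).pair (Computable.snd.pair (he.comp Computable.fst))) :
    Computable fun p : α × ℕ => (L p.1, j p.1, p.2, e p.1))
  have hmod : Computable₂ fun a b : ℕ => a % b := Primrec.nat_mod.to_comp
  have heq : Computable₂ fun a b : ℕ => decide (a = b) := (Primrec.eq (α := ℕ)).decide.to_comp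
  exact heq.comp (hmod.comp (Computable.fst.comp h) (hM.comp Computable.fst))
    (hmod.comp (Computable.snd.comp h) (hM.comp Computable.fst))

end Primrec

theorem solvesMod_iff {n : ℕ} (L : List ℕ) (j M x : ℕ) (t₁ t₂ : TermFG n) :
    solvesMod L j M (Encodable.encode t₁, Encodable.encode t₂) x = true ↔ (M : ℤ) ∣
      ∑ i : Fin n, (termCoeff (.inl i) t₁ - termCoeff (.inl i) t₂) * L.getD (Nat.pair i j) 0 +
        (termCoeff (.inr 0) t₁ - termCoeff (.inr 0) t₂) * x := by
  rw [← evalSides_sub, solvesMod, decide_eq_true_iff]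
  rw [← Int.modEq_iff_dvd, Int.modEq_comm, Int.natCast_modEq_iff, Nat.ModEq]

/-- A bound for the absolute value of the coefficient of `G` in the equation with codes `e`. -/
def coeffBound (e : ℕ × ℕ) : ℕ := (evalSides [] 0 1 e).1 + (evalSides [] 0 1 e).2

theorem computable_coeffBound : Computable coeffBound := by
  have h := primrec_evalSides.comp ((Primrec.const ([] : List ℕ)).pair ((Primrec.const 0).pair
    ((Primrec.const 1).pair Primrec.id)) : Primrec fun e : ℕ × ℕ => ([], 0, 1, e))
  exact (Primrec.nat_add.comp (Primrec.fst.comp h) (Primrec.snd.comp h)).to_comp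

/-- With all F equal to 0 and G = 1, the difference of the two sides is the coefficient of G, and it
is bounded by their sum. -/
theorem natAbs_le_coeffBound {n : ℕ} (t₁ t₂ : TermFG n) :
    (termCoeff (.inr 0) t₁ - termCoeff (.inr 0) t₂).natAbs ≤
      coeffBound (Encodable.encode t₁, Encodable.encode t₂) := by
  have h := evalSides_sub [] 0 1 t₁ t₂
  simp only [List.getD_nil, Nat.cast_zero, mul_zero, Finset.sum_const_zero, zero_add,
    Nat.cast_one, mul_one] at h
  rw [coeffBound]
  omega

/-! ### The Skolem setting of a tree of residues -/

theorem getD_map_range (X : ℕ → ℕ) {K m : ℕ} (h : m < K) :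
    ((List.range K).map X).getD m 0 = X m := by
  rw [List.getD_eq_getElem _ _ (by simpa using h)]
  simp

theorem pair_le_pair_right (a : ℕ) {b c : ℕ} (h : b ≤ c) : Nat.pair a b ≤ Nat.pair a c :=
  (strictMono_nat_of_lt_succ fun m => Nat.pair_lt_pair_right a (Nat.lt_succ_self m)).monotone h

theorem exists_mem_rfind {p : ℕ → Bool} {x : ℕ} (h : p x = true) :
    ∃ y ∈ Nat.rfind (p : ℕ →. Bool), p y = true := by
  obtain ⟨y, hy⟩ := Part.dom_iff_mem.1 ((Nat.rfind_dom (p := (p : ℕ →. Bool))).2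
    ⟨x, Part.mem_some_iff.2 h.symm, fun _ => trivial⟩)
  exact ⟨y, hy, (Part.mem_some_iff.1 (Nat.rfind_spec hy)).symm⟩

theorem computable_pow : Computable₂ fun a b : ℕ => a ^ b :=
  (Primrec₂.unpaired'.1 Nat.Primrec.pow).to_comp

theorem isClopen_of_agree {T : Set (List ℕ)} {n : ℕ} {S : Set (Fin n → Paths T)} (K : ℕ)
    (hS : ∀ f g : Fin n → Paths T, (∀ i, ∀ k < K, (f i).1 k = (g i).1 k) → f ∈ S → g ∈ S) :
    IsClopen S := by
  have hopen : ∀ f : Fin n → Paths T,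
      {g : Fin n → Paths T | ∀ i, ∀ k < K, (g i).1 k = (f i).1 k} ∈ nhds f := by
    intro f
    refine IsOpen.mem_nhds ?_ fun _ _ _ => rfl
    rw [Set.ofPred_forall]
    refine isOpen_iInter_of_finite fun i => ?_
    exact (isOpen_agree (f i).1 K).preimage (continuous_subtype_val.comp (continuous_apply i))
  constructor
  · refine ⟨isOpen_iff_mem_nhds.2 fun f hf => Filter.mem_of_superset (hopen f) fun g hg hgS =>
      hf (hS g f hg hgS)⟩
  · exact isOpen_iff_mem_nhds.2 fun f hf => Filter.mem_of_superset (hopen f) fun g hg =>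
      hS f g (fun i k hk => (hg i k hk).symm) hf

namespace ResidueSystem

variable (R : ResidueSystem)

theorem computable_modulus : Computable R.modulus :=
  computable_pow.comp (R.computable_q.comp R.computable_comp)
    (Computable.succ.comp R.computable_lvl)

theorem computable_prevModulus : Computable R.prevModulus :=
  computable_pow.comp (R.computable_q.comp R.computable_comp) R.computable_lvl

theorem computable_pred : Computable R.pred :=
  R.computable_idx.comp R.computable_comp (Primrec.pred.to_comp.comp R.computable_lvl)

theorem computable_tree : ComputablePred fun σ : List ℕ => σ ∈ R.tree := by
  have hget : Computable₂ fun (σ : List ℕ) (j : ℕ) => σ.getD j 0 := (Primrec.list_getD 0).to_comp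
  have hmod : Computable₂ fun a b : ℕ => a % b := Primrec.nat_mod.to_comp
  have heq : Computable₂ fun a b : ℕ => decide (a = b) := (Primrec.eq (α := ℕ)).decide.to_comp
  have hlt : Computable₂ fun a b : ℕ => decide (a < b) := Primrec.nat_lt.decide.to_comp
  have h2 : Computable fun p : List ℕ × ℕ => p.2 := Computable.snd
  have hcur : Computable fun p : List ℕ × ℕ => p.1.getD p.2 0 := hget
  have hprev : Computable fun p : List ℕ × ℕ => p.1.getD (R.pred p.2) 0 :=
    hget.comp Computable.fst (R.computable_pred.comp h2)
  have hp : Computable₂ fun (σ : List ℕ) (j : ℕ) => decide (σ.getD j 0 < R.modulus j) &&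
      decide (σ.getD j 0 % R.prevModulus j = σ.getD (R.pred j) 0 % R.prevModulus j) :=
    Primrec.and.to_comp.comp (hlt.comp hcur (R.computable_modulus.comp h2))
      (heq.comp (hmod.comp hcur (R.computable_prevModulus.comp h2))
        (hmod.comp hprev (R.computable_prevModulus.comp h2)))
  refine ComputablePred.computable_iff.2 ⟨_, computable_forall_lt hp
    (Primrec.list_length (α := ℕ)).to_comp, ?_⟩
  funext σ
  simp [tree, Nat.ModEq]

theorem computable_add : ∃ Φ, IsTuringFunctional Φ ∧ ∀ (P Q : Paths R.tree) (k : ℕ),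
    Φ (joinOracle ![P, Q]) k = Part.some ((P + Q).1 k) := by
  have hB : Computable fun k : ℕ => Nat.pair 0 k + Nat.pair 1 k + 1 :=
    (Primrec.succ.comp (Primrec.nat_add.comp
      (Primrec₂.natPair.comp (Primrec.const 0) Primrec.id)
      (Primrec₂.natPair.comp (Primrec.const 1) Primrec.id))).to_comp
  have hsum : Primrec₂ fun (k : ℕ) (L : List ℕ) =>
      L.getD (Nat.pair 0 k) 0 + L.getD (Nat.pair 1 k) 0 :=
    Primrec.nat_add.comp
      ((Primrec.list_getD 0).comp Primrec.snd
        (Primrec₂.natPair.comp (Primrec.const 0) Primrec.fst))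
      ((Primrec.list_getD 0).comp Primrec.snd
        (Primrec₂.natPair.comp (Primrec.const 1) Primrec.fst))
  have hmod : Computable₂ fun a b : ℕ => a % b := Primrec.nat_mod.to_comp
  have hg : Computable₂ fun (k : ℕ) (L : List ℕ) =>
      (L.getD (Nat.pair 0 k) 0 + L.getD (Nat.pair 1 k) 0) % R.modulus k :=
    hmod.comp hsum.to_comp (R.computable_modulus.comp Computable.fst)
  refine ⟨_, IsTuringFunctional.of_initialSegment_total hB hg, fun P Q k => ?_⟩
  simp only
  rw [getD_map_range _ (by omega), getD_map_range _ (by omega)]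
  have h0 := joinOracle_pair ![P, Q] 0 k
  have h1 := joinOracle_pair ![P, Q] 1 k
  rw [add_apply]
  simp only [Fin.val_zero, Fin.val_one] at h0 h1
  rw [h0, h1]
  rfl

/-- The constant part of the equation `t₁ = t₂`. -/
def constPart {n : ℕ} (t₁ t₂ : TermFG n) (f : Fin n → Paths R.tree) : Paths R.tree :=
  linForm (fun i => termCoeff (.inl i) t₁ - termCoeff (.inl i) t₂) f

theorem solvesMod_join_iff {n : ℕ} (t₁ t₂ : TermFG n) (f : Fin n → Paths R.tree) {j K : ℕ}
    (hK : Nat.pair n j ≤ K) (x : ℕ) :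
    solvesMod ((List.range K).map (joinOracle f)) j (R.modulus j)
      (Encodable.encode t₁, Encodable.encode t₂) x = true ↔ (R.modulus j : ℤ) ∣
        (R.constPart t₁ t₂ f).1 j + (termCoeff (.inr 0) t₁ - termCoeff (.inr 0) t₂) * x := by
  have h1 : ∀ i : Fin n, ((List.range K).map (joinOracle f)).getD (Nat.pair i j) 0 =
      (f i).1 j := fun i => by
    rw [getD_map_range _ ((Nat.pair_lt_pair_left j i.2).trans_le hK), joinOracle_pair]
  rw [solvesMod_iff]
  simp only [h1]
  exact ((R.linForm_modEq _ f j).symm.add_right _).dvd_iff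

/-- Both quantifiers on the right are bounded, so this gives the decision procedure; it also
involves only finitely many positions of f, which gives clopenness. -/
theorem exists_witness_iff {n : ℕ} (t₁ t₂ : TermFG n) (hp : IsProper t₁ t₂)
    (f : Fin n → Paths R.tree) {B : ℕ}
    (hB : (termCoeff (.inr 0) t₁ - termCoeff (.inr 0) t₂).natAbs ≤ B) :
    (existsEq t₁ t₂).Realize f ↔ ∀ c < B + 1, ∃ x < R.modulus (R.idx c B),
      (R.modulus (R.idx c B) : ℤ) ∣ (R.constPart t₁ t₂ f).1 (R.idx c B) +
        (termCoeff (.inr 0) t₁ - termCoeff (.inr 0) t₂) * (x : ℕ) := by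
  rw [realize_existsEq_iff]
  simp only [realize_bdEqual_iff]
  constructor
  · rintro ⟨g, hg⟩ c _
    exact ⟨g.1 _, R.path_lt g _, (R.add_smul_eq_zero_iff _ _ _).1 hg _⟩
  · intro h
    refine R.exists_solution _ ((isProper_iff t₁ t₂).1 hp) hB fun c hc => ?_
    obtain ⟨x, -, hx⟩ := h c (Nat.lt_succ_of_le hc)
    exact ⟨x, hx⟩

theorem clopen {n : ℕ} (t₁ t₂ : TermFG n) (hp : IsProper t₁ t₂) :
    IsClopen {f : Fin n → Paths R.tree | (existsEq t₁ t₂).Realize f} := by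
  set B := (termCoeff (.inr 0) t₁ - termCoeff (.inr 0) t₂).natAbs with hB
  -- The positions tested are those on level B of the components c ≤ B, and none exceeds the
  -- position of component B.
  refine isClopen_of_agree (R.idx B B + 1) fun f g hfg hf => ?_
  rw [Set.mem_ofPred_eq, R.exists_witness_iff t₁ t₂ hp _ hB.ge] at hf ⊢
  intro c hc
  obtain ⟨x, hx, hdvd⟩ := hf c hc
  refine ⟨x, hx, ?_⟩
  rw [← R.solvesMod_join_iff t₁ t₂ _ le_rfl, solvesMod_iff] at hdvd ⊢
  have h1 : ∀ (f : Fin n → Paths R.tree) (i : Fin n),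
      ((List.range (Nat.pair n (R.idx c B))).map (joinOracle f)).getD
        (Nat.pair i (R.idx c B)) 0 = (f i).1 (R.idx c B) := fun f i => by
    rw [getD_map_range _ (Nat.pair_lt_pair_left _ i.2), joinOracle_pair]
  simp only [h1] at hdvd ⊢
  simpa only [hfg _ _ (Nat.lt_succ_of_le (R.idx_mono_left c B B (by omega)))] using hdvd

theorem decidable : ∃ Θ, IsTuringFunctional Θ ∧
    ∀ (n : ℕ) (t₁ t₂ : TermFG n), IsProper t₁ t₂ → ∀ f : Fin n → Paths R.tree,
      ((existsEq t₁ t₂).Realize f → Θ (joinOracle f) (eqCode t₁ t₂) = Part.some 1) ∧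
      (¬ (existsEq t₁ t₂).Realize f → Θ (joinOracle f) (eqCode t₁ t₂) = Part.some 0) := by
  have hcode : Computable fun m : ℕ => m.unpair.2.unpair :=
    Computable.unpair.comp (Computable.snd.comp Computable.unpair)
  have hbd : Computable fun m : ℕ => coeffBound m.unpair.2.unpair :=
    computable_coeffBound.comp hcode
  have hB : Computable fun m : ℕ => Nat.pair m.unpair.1
      (R.idx (coeffBound m.unpair.2.unpair) (coeffBound m.unpair.2.unpair)) :=
    Primrec₂.natPair.to_comp.comp (Computable.fst.comp Computable.unpair)
      (R.computable_idx.comp hbd hbd)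
  have hm1 : Computable fun p : (ℕ × List ℕ) × ℕ => p.1.1 := Computable.fst.comp Computable.fst
  have hidx : Computable fun p : (ℕ × List ℕ) × ℕ =>
      R.idx p.2 (coeffBound p.1.1.unpair.2.unpair) :=
    R.computable_idx.comp Computable.snd (hbd.comp hm1)
  have hsol := computable_solvesMod (Computable.snd.comp Computable.fst) hidx
    (R.computable_modulus.comp hidx) (hcode.comp hm1)
  have hex := computable_exists_lt hsol (R.computable_modulus.comp hidx)
  have hall := computable_forall_lt (p := fun (a : ℕ × List ℕ) c => decide
    (∃ x < R.modulus (R.idx c (coeffBound a.1.unpair.2.unpair)), solvesMod a.2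
      (R.idx c (coeffBound a.1.unpair.2.unpair))
      (R.modulus (R.idx c (coeffBound a.1.unpair.2.unpair))) a.1.unpair.2.unpair x = true)) hex
    (Computable.succ.comp (hbd.comp Computable.fst))
  have hres := Computable.cond hall (Computable.const 1) (Computable.const 0)
  refine ⟨_, IsTuringFunctional.of_initialSegment_total hB hres,
    fun n t₁ t₂ hp f => ?_⟩
  have hiff := R.exists_witness_iff t₁ t₂ hp f (natAbs_le_coeffBound t₁ t₂)
  have hgood : ∀ c < coeffBound (Encodable.encode t₁, Encodable.encode t₂) + 1, ∀ x, _ :=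
    fun c hc x => R.solvesMod_join_iff t₁ t₂ f (j := R.idx c
      (coeffBound (Encodable.encode t₁, Encodable.encode t₂)))
      (K := Nat.pair n (R.idx (coeffBound (Encodable.encode t₁, Encodable.encode t₂))
        (coeffBound (Encodable.encode t₁, Encodable.encode t₂))))
      (pair_le_pair_right n (R.idx_mono_left _ _ _ (Nat.le_of_lt_succ hc))) x
  simp only [eqCode, Nat.unpair_pair, decide_eq_true_iff]
  have hiff' : (existsEq t₁ t₂).Realize f ↔ _ :=
    hiff.trans (forall₂_congr fun c hc => exists_congr fun x =>
      and_congr_right fun _ => (hgood c hc x).symm)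
  constructor
  · intro h
    exact congrArg (fun b : Bool => Part.some (bif b then 1 else 0))
      (decide_eq_true (hiff'.1 h))
  · intro h
    exact congrArg (fun b : Bool => Part.some (bif b then 1 else 0))
      (decide_eq_false (mt hiff'.2 h))

theorem computable_witness : ∃ Ψ, IsTuringFunctional Ψ ∧
    ∀ (n : ℕ) (t₁ t₂ : TermFG n), IsProper t₁ t₂ → ∀ (f : Fin n → Paths R.tree) (g : Paths R.tree),
      (t₁.bdEqual t₂).Realize f (fun _ => g) →
        ∀ k, Ψ (joinOracle f) (Nat.pair (eqCode t₁ t₂) k) = Part.some (g.1 k) := by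
  have hm : Computable fun m : ℕ => m.unpair.1 := Computable.fst.comp Computable.unpair
  have hk : Computable fun m : ℕ => m.unpair.2 := Computable.snd.comp Computable.unpair
  have hcode : Computable fun m : ℕ => m.unpair.1.unpair.2.unpair :=
    Computable.unpair.comp (Computable.snd.comp (Computable.unpair.comp hm))
  have hpos : Computable fun m : ℕ => R.idx (R.comp m.unpair.2)
      (R.lvl m.unpair.2 + coeffBound m.unpair.1.unpair.2.unpair) :=
    R.computable_idx.comp (R.computable_comp.comp hk) (Primrec.nat_add.to_comp.comp
      (R.computable_lvl.comp hk) (computable_coeffBound.comp hcode))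
  have hB : Computable fun m : ℕ => Nat.pair m.unpair.1.unpair.1 (R.idx (R.comp m.unpair.2)
      (R.lvl m.unpair.2 + coeffBound m.unpair.1.unpair.2.unpair)) :=
    Primrec₂.natPair.to_comp.comp (Computable.fst.comp (Computable.unpair.comp hm)) hpos
  have hfst : Computable fun p : ℕ × List ℕ => p.1 := Computable.fst
  have hsol := computable_solvesMod (Computable.snd (α := ℕ) (β := List ℕ)) (hpos.comp hfst)
    (R.computable_modulus.comp (hpos.comp hfst)) (hcode.comp hfst)
  have hmod : Computable₂ fun a b : ℕ => a % b := Primrec.nat_mod.to_comp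
  have hout : Computable₂ fun (p : ℕ × List ℕ) (x : ℕ) => x % R.modulus p.1.unpair.2 :=
    hmod.comp Computable.snd (R.computable_modulus.comp (hk.comp (hfst.comp Computable.fst)))
  -- Any solution modulo the higher power will do: the search takes the first one and reduces it to
  -- the modulus at k. The search ends because the witness itself supplies a solution.
  have hres := (Partrec.rfind hsol.partrec₂).map hout
  refine ⟨_, IsTuringFunctional.of_initialSegment hB
    hres, fun n t₁ t₂ hp f g hg k => ?_⟩
  have hb := (isProper_iff t₁ t₂).1 hp
  rw [realize_bdEqual_iff] at hg
  simp only [eqCode, Nat.unpair_pair]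
  set B := coeffBound (Encodable.encode t₁, Encodable.encode t₂) with hBdef
  have hiff := R.solvesMod_join_iff t₁ t₂ f (le_refl
    (Nat.pair n (R.idx (R.comp k) (R.lvl k + B))))
  refine Part.eq_some_iff.2 ((Part.mem_map_iff _).2 ?_)
  obtain ⟨x, hx, hx'⟩ := exists_mem_rfind ((hiff _).2 ((R.add_smul_eq_zero_iff _ _ _).1 hg _))
  refine ⟨x, hx, ?_⟩
  have hx1 := (hiff x).1 hx'
  have hx2 := R.solution_modEq hb (natAbs_le_coeffBound t₁ t₂) hg k hx1
  have hx3 := Int.natCast_modEq_iff.1 hx2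
  rw [Nat.ModEq, Nat.mod_eq_of_lt (R.path_lt g k)] at hx3
  exact hx3

theorem skolemSetting : SkolemSetting R.tree where
  prefix_closed := R.tree_prefix_closed
  computable_tree := R.computable_tree
  extendible := R.tree_extendible
  computable_branching := ⟨fun σ => R.q (R.comp σ.length),
    R.computable_q.comp (R.computable_comp.comp (Primrec.list_length (α := ℕ)).to_comp),
    R.tree_branching⟩
  no_isolated := R.tree_no_isolated
  computable_add := R.computable_add
  torsion_free m P hm h := R.eq_zero_of_smul_eq_zero (Nat.cast_ne_zero.2 hm)
    ((natCast_zsmul P m).trans h)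
  clopen _ t₁ t₂ := R.clopen t₁ t₂
  decidable := R.decidable
  unique_witness _ t₁ t₂ hp f g g' hg hg' := by
    rw [realize_bdEqual_iff] at hg hg'
    exact linear_solution_unique (fun _ _ hm hz => R.eq_zero_of_smul_eq_zero hm hz)
      ((isProper_iff t₁ t₂).1 hp) hg hg'
  computable_witness := R.computable_witness

end ResidueSystem

/-! ### The additive group of the `p`-adic integers -/

/-- The residues modulo the powers of one prime. -/
def padicSystem (p : ℕ) (hp : p.Prime) : ResidueSystem where
  comp _ := 0
  lvl j := j
  idx _ l := l
  q _ := p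
  prime _ := hp
  q_comp_idx _ _ := rfl
  lvl_idx _ _ := rfl
  idx_comp_lvl _ := rfl
  idx_comp_idx _ _ _ := rfl
  idx_strictMono _ := strictMono_id
  idx_mono_left _ _ _ _ := le_rfl
  comp_le _ := Nat.zero_le _
  computable_comp := Computable.const 0
  computable_lvl := Computable.id
  computable_idx := Computable.snd
  computable_q := Computable.const p

theorem padicTree_eq (p : ℕ) (hp : p.Prime) : padicTree p = (padicSystem p hp).tree := by
  ext σ
  have hget : ∀ i (h : i < σ.length), σ.getD i 0 = σ[i] := fun i h => List.getD_eq_getElem _ _ h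
  constructor
  · rintro ⟨h1, h2⟩ j hj
    refine ⟨by rw [hget j hj]; exact h1 j hj, ?_⟩
    cases j with
    | zero => exact Nat.modEq_one
    | succ j =>
      have h3 : (padicSystem p hp).pred (j + 1) = j := rfl
      rw [h3, hget _ hj, hget j (by omega)]
      exact h2 j hj
  · intro h
    refine ⟨fun i hi => ?_, fun i hi => ?_⟩
    · rw [← hget i hi]; exact (h i hi).1
    · have := (h (i + 1) hi).2
      rw [show (padicSystem p hp).pred (i + 1) = i from rfl, hget _ hi, hget i (by omega)] at this
      exact this

theorem padicSystem_path_modEq {p : ℕ} (hp : p.Prime) (P : Paths (padicSystem p hp).tree) (i : ℕ) :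
    (P.1 (i + 1) : ℤ) ≡ P.1 i [ZMOD (p : ℤ) ^ (i + 1)] :=
  (padicSystem p hp).path_idx_modEq P 0 i 1

/-- The paths of `T_p^+` form the additive group of the `p`-adic integers. -/
theorem nonempty_paths_addEquiv_padicInt (p : ℕ) [hp : Fact p.Prime] :
    Nonempty (Paths (padicSystem p hp.out).tree ≃+ ℤ_[p]) := by
  let R := padicSystem p hp.out
  let F : ℤ_[p] → ℕ → ℤ := fun x j => ((PadicInt.toZModPow (j + 1) x).val : ℤ)
  have hF : ∀ x j, ((F x j : ℤ) : ZMod (p ^ (j + 1))) = PadicInt.toZModPow (j + 1) x := by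
    intro x j
    simp [F]
  have hcond : ∀ x j, F x j ≡ F x (R.pred j) [ZMOD R.prevModulus j] := by
    intro x j
    cases j with
    | zero => rfl
    | succ j =>
      change F x (j + 1) ≡ F x j [ZMOD ((p ^ (j + 1) : ℕ) : ℤ)]
      rw [← ZMod.intCast_eq_intCast_iff, hF, ← PadicInt.cast_toZModPow _ _ (Nat.le_succ (j + 1)),
        ← hF x (j + 1), ZMod.cast_intCast (pow_dvd_pow p (Nat.le_succ (j + 1)))]
  have hres : ∀ x j, R.residues (R.mkPath (F x) (hcond x)) j = PadicInt.toZModPow (j + 1) x :=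
    fun x j => (R.residues_mkPath _ _ j).trans (hF x j)
  let φ : ℤ_[p] →+ Paths R.tree := AddMonoidHom.mk' (fun x => R.mkPath (F x) (hcond x)) <| by
    intro x y
    refine R.residues_injective (funext fun j => ?_)
    rw [hres]
    refine Eq.trans ?_ ((map_add (R.residueHom j) _ _).symm)
    exact (map_add _ x y).trans (congrArg₂ (· + ·) (hres x j).symm (hres y j).symm)
  refine ⟨(AddEquiv.ofBijective φ ⟨?_, ?_⟩).symm⟩
  · intro x y hxy
    refine PadicInt.ext_of_toZModPow.1 fun n => ?_
    have h1 : PadicInt.toZModPow (n + 1) x = PadicInt.toZModPow (n + 1) y := by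
      rw [← hres x n, ← hres y n]
      exact congrArg (fun P => R.residues P n) hxy
    rw [← PadicInt.cast_toZModPow _ _ (Nat.le_succ n), h1,
      PadicInt.cast_toZModPow _ _ (Nat.le_succ n)]
  · intro P
    -- The entries of a path form a Cauchy sequence. Entry i is a residue modulo p ^ (i + 1), one
    -- power more than this divisibility uses; hence the reduction modulo p ^ (j + 1) returns entry
    -- j + 1, and compatibility brings it back to entry j.
    have hdvd : ∀ i, (p : ℤ) ^ i ∣ (P.1 (i + 1) : ℤ) - P.1 i := fun i =>
      (pow_dvd_pow _ (Nat.le_succ i)).trans (padicSystem_path_modEq hp.out P i).symm.dvd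
    refine ⟨PadicInt.ofIntSeq _
      (PadicInt.isCauSeq_padicNorm_of_pow_dvd_sub (fun i => (P.1 i : ℤ)) p hdvd),
      R.residues_injective (funext fun j => (hres _ j).trans ?_)⟩
    rw [PadicInt.toZModPow_ofIntSeq_of_pow_dvd_sub (fun i => (P.1 i : ℤ)) p hdvd]
    refine (ZMod.intCast_eq_intCast_iff _ _ _).2 ?_
    have := padicSystem_path_modEq hp.out P j
    exact_mod_cast this

/-! ### The product over all primes -/

theorem computable_nth_prime : Computable (Nat.nth Nat.Prime) := by
  have heq : Computable₂ fun a b : ℕ => decide (a = b) := (Primrec.eq (α := ℕ)).decide.to_comp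
  have hle : Computable fun a : ℕ => decide (2 ≤ a) :=
    (Primrec.nat_le.decide.comp (Primrec.const 2) Primrec.id).to_comp
  have hmod : Computable₂ fun a b : ℕ => a % b := Primrec.nat_mod.to_comp
  have hdiv : Computable₂ fun a b : ℕ => !decide (a % b = 0) || decide (b = 1) :=
    Primrec.or.to_comp.comp (Primrec.not.to_comp.comp (heq.comp hmod (Computable.const 0)))
      (heq.comp Computable.snd (Computable.const 1))
  have hprime : Computable fun a : ℕ => decide a.Prime := by
    refine (Primrec.and.to_comp.comp hle (computable_forall_lt hdiv Computable.id)).of_eq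
      fun a => ?_
    rw [Bool.eq_iff_iff, decide_eq_true_iff, Nat.prime_def_lt]
    simp only [Bool.and_eq_true, decide_eq_true_eq, Bool.or_eq_true, Bool.not_eq_true',
      decide_eq_false_iff_not, id_eq, Nat.dvd_iff_mod_eq_zero, imp_iff_not_or]
  have hcount : Computable fun a : ℕ => Nat.count Nat.Prime a := by
    have h : Computable fun a : ℕ => Nat.rec (motive := fun _ => ℕ) 0
        (fun k r => r + bif decide k.Prime then 1 else 0) a := by
      refine Computable.nat_rec (h := fun _ p => p.2 + bif decide p.1.Prime then 1 else 0)
        Computable.id (Computable.const 0) ?_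
      have h1 : Computable fun p : ℕ × ℕ × ℕ => p.2.1 := Computable.fst.comp Computable.snd
      have h2 : Computable fun p : ℕ × ℕ × ℕ => p.2.2 := Computable.snd.comp Computable.snd
      exact Primrec.nat_add.to_comp.comp h2
        (Computable.cond (hprime.comp h1) (Computable.const 1) (Computable.const 0))
    refine h.of_eq fun a => ?_
    induction a with
    | zero => simp
    | succ a ih =>
      simp only [ih, Nat.count_succ]
      by_cases ha : a.Prime <;> simp [ha]
  have htest : Computable₂ fun i k : ℕ => decide k.Prime && decide (Nat.count Nat.Prime k = i) :=
    Primrec.and.to_comp.comp (hprime.comp Computable.snd)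
      (heq.comp (hcount.comp Computable.snd) Computable.fst)
  refine Partrec.of_eq_tot (Partrec.rfind htest.partrec₂) fun i => ?_
  have hi : (decide (Nat.nth Nat.Prime i).Prime &&
      decide (Nat.count Nat.Prime (Nat.nth Nat.Prime i) = i)) = true := by
    simp [Nat.prime_nth_prime, Nat.count_nth_of_infinite Nat.infinite_setOfPred_prime]
  obtain ⟨y, hy, hy'⟩ := exists_mem_rfind
    (p := fun k => decide k.Prime && decide (Nat.count Nat.Prime k = i)) hi
  simp only [Bool.and_eq_true, decide_eq_true_eq] at hy'
  have : y = Nat.nth Nat.Prime i := by rw [← hy'.2, Nat.nth_count hy'.1]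
  rwa [← this]

/-- The residues modulo all prime powers. -/
noncomputable def zhatSystem : ResidueSystem where
  comp j := j.unpair.1
  lvl j := j.unpair.2
  idx := Nat.pair
  q := Nat.nth Nat.Prime
  prime := Nat.prime_nth_prime
  q_comp_idx _ _ := by rw [Nat.unpair_pair]
  lvl_idx _ _ := by rw [Nat.unpair_pair]
  idx_comp_lvl := Nat.pair_unpair
  idx_comp_idx _ _ _ := by rw [Nat.unpair_pair]
  idx_strictMono c := strictMono_nat_of_lt_succ fun m =>
    Nat.pair_lt_pair_right c (Nat.lt_succ_self m)
  idx_mono_left c c' l h := (strictMono_nat_of_lt_succ (f := fun c => Nat.pair c l) fun m =>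
    Nat.pair_lt_pair_left l (Nat.lt_succ_self m)).monotone h
  comp_le _ := (Nat.nth_strictMono Nat.infinite_setOfPred_prime).le_apply
  computable_comp := Computable.fst.comp Computable.unpair
  computable_lvl := Computable.snd.comp Computable.unpair
  computable_idx := Primrec₂.natPair.to_comp
  computable_q := computable_nth_prime

theorem nodeComponent_eq (i : ℕ) (σ : List ℕ) : ∃ K, (∀ l, l < K ↔ Nat.pair i l < σ.length) ∧
    nodeComponent i σ = (List.range K).map fun l => σ.getD (Nat.pair i l) 0 := by
  have hmono : StrictMono (Nat.pair i) := zhatSystem.idx_strictMono i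
  -- Pairing is increasing in the level, so the levels of component i that σ reaches form an initial
  -- segment.
  obtain ⟨K, hK, hKlen⟩ : ∃ K, (∀ l, l < K ↔ Nat.pair i l < σ.length) ∧ K ≤ σ.length := by
    have hex : ∃ K, ¬ Nat.pair i K < σ.length := ⟨σ.length, not_lt.2 hmono.le_apply⟩
    refine ⟨Nat.find hex, fun l => ?_, Nat.find_min' hex (not_lt.2 hmono.le_apply)⟩
    rw [Nat.lt_find_iff]
    refine ⟨fun h => not_not.1 (h l le_rfl), fun h m hm => not_not.2 ?_⟩
    exact (hmono.monotone hm).trans_lt h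
  refine ⟨K, hK, ?_⟩
  obtain ⟨d, hd⟩ := Nat.exists_eq_add_of_le hKlen
  rw [nodeComponent, hd, List.range_add, List.filterMap_append]
  have h1 : (List.range K).filterMap (fun l => σ[Nat.pair i l]?) =
      (List.range K).map fun l => σ.getD (Nat.pair i l) 0 := by
    rw [← List.filterMap_eq_map]
    refine List.filterMap_congr fun l hl => ?_
    have := (hK l).1 (List.mem_range.1 hl)
    simp [List.getD, this]
  have h2 : ((List.range d).map (K + ·)).filterMap (fun l => σ[Nat.pair i l]?) = [] := by
    refine List.filterMap_eq_nil_iff.2 fun l hl => ?_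
    obtain ⟨m, -, rfl⟩ := List.mem_map.1 hl
    exact List.getElem?_eq_none (not_lt.1 fun h => by have := (hK _).2 h; omega)
  rw [h1, h2, List.append_nil]

theorem zhatTree_eq : zhatTree = zhatSystem.tree := by
  ext σ
  have hcomp : ∀ i, nodeComponent i σ ∈ padicTree (Nat.nth Nat.Prime i) ↔
      ∀ l, Nat.pair i l < σ.length → σ.getD (Nat.pair i l) 0 < Nat.nth Nat.Prime i ^ (l + 1) ∧
        σ.getD (Nat.pair i l) 0 ≡ σ.getD (Nat.pair i (l - 1)) 0
          [MOD Nat.nth Nat.Prime i ^ l] := by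
    intro i
    obtain ⟨K, hK, heq⟩ := nodeComponent_eq i σ
    rw [heq, padicTree_eq _ (Nat.prime_nth_prime i), ResidueSystem.map_range_mem_tree]
    exact forall_congr' fun l => by rw [hK]; exact Iff.rfl
  change (∀ i, nodeComponent i σ ∈ padicTree (Nat.nth Nat.Prime i)) ↔ _
  simp only [hcomp]
  constructor
  · intro h j hj
    have := h j.unpair.1 j.unpair.2
    rw [Nat.pair_unpair] at this
    exact this hj
  · intro h i l hl
    have := h (Nat.pair i l) hl
    have hm : zhatSystem.modulus (Nat.pair i l) = Nat.nth Nat.Prime i ^ (l + 1) :=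
      zhatSystem.modulus_idx i l
    have hm' : zhatSystem.prevModulus (Nat.pair i l) = Nat.nth Nat.Prime i ^ l :=
      zhatSystem.prevModulus_idx i l
    rw [hm, hm'] at this
    refine ⟨this.1, ?_⟩
    have h2 := this.2
    have hp : zhatSystem.pred (Nat.pair i l) = Nat.pair i (l - 1) := by
      change Nat.pair (Nat.pair i l).unpair.1 ((Nat.pair i l).unpair.2 - 1) = _
      rw [Nat.unpair_pair]
    rwa [hp] at h2

/-! ### The profinite completion of `ℤ` -/

theorem int_dvd_of_forall_prime_pow_dvd {m : ℕ} {y : ℤ}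
    (h : ∀ i l, Nat.nth Nat.Prime i ^ (l + 1) ∣ m → ((Nat.nth Nat.Prime i ^ (l + 1) : ℕ) : ℤ) ∣ y) :
    (m : ℤ) ∣ y := by
  rw [← Int.dvd_natAbs, Int.natCast_dvd_natCast, Nat.dvd_iff_prime_pow_dvd_dvd]
  intro p k hp hk
  cases k with
  | zero => simp
  | succ k =>
    have := h (Nat.count Nat.Prime p) k (by rwa [Nat.nth_count hp])
    rwa [Nat.nth_count hp, ← Int.dvd_natAbs, Int.natCast_dvd_natCast] at this

/-- The integer `z` agrees with the path `P` modulo the powers with exponent `K + 1` of the first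
`K` primes. -/
def ApproximatesTo (P : Paths zhatSystem.tree) (K : ℕ) (z : ℤ) : Prop :=
  ∀ i < K, z ≡ P.1 (Nat.pair i K) [ZMOD (Nat.nth Nat.Prime i : ℤ) ^ (K + 1)]

theorem zhat_path_modEq (P : Paths zhatSystem.tree) (i : ℕ) {l K : ℕ} (h : l ≤ K) :
    (P.1 (Nat.pair i K) : ℤ) ≡ P.1 (Nat.pair i l) [ZMOD (Nat.nth Nat.Prime i : ℤ) ^ (l + 1)] := by
  have := zhatSystem.path_idx_modEq P i l (K - l)
  rw [Nat.add_sub_cancel' h] at this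
  exact this

namespace ApproximatesTo

theorem exists_int (P : Paths zhatSystem.tree) (K : ℕ) : ∃ z, ApproximatesTo P K z := by
  obtain ⟨z, hz⟩ := Nat.chineseRemainderOfFinset (fun i => P.1 (Nat.pair i K))
    (fun i => Nat.nth Nat.Prime i ^ (K + 1)) (Finset.range K)
    (fun i _ => pow_ne_zero _ (Nat.prime_nth_prime i).ne_zero) <| by
      intro i _ j _ hij
      refine Nat.Coprime.pow _ _ ((Nat.coprime_primes (Nat.prime_nth_prime i)
        (Nat.prime_nth_prime j)).2 fun h => hij ?_)
      exact Nat.nth_injective Nat.infinite_setOfPred_prime h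
  refine ⟨z, fun i hi => ?_⟩
  exact_mod_cast Int.natCast_modEq_iff.2 (hz i (Finset.mem_range.2 hi))

variable {P Q : Paths zhatSystem.tree} {K : ℕ} {z w : ℤ}

theorem modEq (h : ApproximatesTo P K z) {i l : ℕ} (hi : i < K) (hl : l ≤ K) :
    z ≡ P.1 (Nat.pair i l) [ZMOD (Nat.nth Nat.Prime i : ℤ) ^ (l + 1)] :=
  ((h i hi).of_dvd (pow_dvd_pow _ (by omega))).trans (zhat_path_modEq P i hl)

theorem mono (h : ApproximatesTo P K z) {K' : ℕ} (hK : K' ≤ K) : ApproximatesTo P K' z :=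
  fun _ hi => h.modEq (hi.trans_le hK) hK

theorem add (h : ApproximatesTo P K z) (h' : ApproximatesTo Q K w) :
    ApproximatesTo (P + Q) K (z + w) := by
  intro i hi
  refine ((h i hi).add (h' i hi)).trans ?_
  have h1 := zhatSystem.add_apply P Q (Nat.pair i K)
  have h2 : zhatSystem.modulus (Nat.pair i K) = Nat.nth Nat.Prime i ^ (K + 1) :=
    zhatSystem.modulus_idx i K
  rw [h1, h2]
  push_cast
  exact (Int.mod_modEq _ _).symm

/-- Approximations determine residues modulo small numbers. -/
theorem dvd_sub {m : ℕ} (hm0 : m ≠ 0) (hm : m ≤ K)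
    (hw : ∀ i l, Nat.nth Nat.Prime i ^ (l + 1) ∣ m →
      w ≡ P.1 (Nat.pair i l) [ZMOD (Nat.nth Nat.Prime i : ℤ) ^ (l + 1)])
    (h : ApproximatesTo P K z) : (m : ℤ) ∣ z - w := by
  refine int_dvd_of_forall_prime_pow_dvd fun i l hil => ?_
  -- A prime power dividing m is at most K. This bounds its exponent, and since the i-th prime
  -- exceeds i, also its index; so the approximation controls it.
  have hle := (Nat.le_of_dvd (Nat.pos_of_ne_zero hm0) hil).trans hm
  have h1 : l + 1 < Nat.nth Nat.Prime i ^ (l + 1) :=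
    Nat.lt_pow_self (Nat.prime_nth_prime i).one_lt
  have h2 : Nat.nth Nat.Prime i ≤ Nat.nth Nat.Prime i ^ (l + 1) := Nat.le_self_pow (by omega) _
  have h3 := Nat.add_two_le_nth_prime i
  push_cast
  exact ((hw i l hil).trans (h.modEq (by omega) (by omega)).symm).dvd

theorem dvd_sub_of_approximatesTo {m : ℕ} (hm0 : m ≠ 0) (hm : m ≤ K) (h : ApproximatesTo P K z)
    {K' : ℕ} (hm' : m ≤ K') (h' : ApproximatesTo P K' w) : (m : ℤ) ∣ z - w := by
  refine (h.mono hm).dvd_sub hm0 le_rfl fun i l hil => ?_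
  have hle := Nat.le_of_dvd (Nat.pos_of_ne_zero hm0) hil
  have h1 : l + 1 < Nat.nth Nat.Prime i ^ (l + 1) :=
    Nat.lt_pow_self (Nat.prime_nth_prime i).one_lt
  have h2 : Nat.nth Nat.Prime i ≤ Nat.nth Nat.Prime i ^ (l + 1) := Nat.le_self_pow (by omega) _
  have h3 := Nat.add_two_le_nth_prime i
  exact h'.modEq (by omega) (by omega)

end ApproximatesTo

/-- The subgroup of the multiples of `m ≠ 0`. -/
def multiplesSubgroup (m : ℕ) (hm : m ≠ 0) : FiniteIndexNormalAddSubgroup ℤ :=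
  { AddSubgroup.zmultiples (m : ℤ) with
    isNormal' := inferInstance
    isFiniteIndex' := ⟨by rw [Int.index_zmultiples]; simpa using hm⟩ }

/-- The index annihilates the quotient by H, so residues modulo the index determine cosets of H. -/
theorem mem_of_index_dvd (H : FiniteIndexNormalAddSubgroup ℤ) {z : ℤ}
    (h : (H.toAddSubgroup.index : ℤ) ∣ z) : z ∈ H.toAddSubgroup := by
  obtain ⟨c, rfl⟩ := h
  have := H.toAddSubgroup.nsmul_index_mem c
  rwa [nsmul_eq_mul] at this

theorem index_ne_zero (H : FiniteIndexNormalAddSubgroup ℤ) : H.toAddSubgroup.index ≠ 0 :=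
  H.isFiniteIndex'.index_ne_zero

theorem mk_eq_of_approximatesTo (P : Paths zhatSystem.tree) (H : FiniteIndexNormalAddSubgroup ℤ)
    {K K' : ℕ} {z w : ℤ} (hK : H.toAddSubgroup.index ≤ K) (hz : ApproximatesTo P K z)
    (hK' : H.toAddSubgroup.index ≤ K') (hw : ApproximatesTo P K' w) :
    (QuotientAddGroup.mk z : ℤ ⧸ H.toAddSubgroup) = QuotientAddGroup.mk w := by
  refine QuotientAddGroup.eq.2 (mem_of_index_dvd H ?_)
  rw [neg_add_eq_sub]
  exact hw.dvd_sub_of_approximatesTo (index_ne_zero H) hK' hK hz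

/-- The element of the profinite completion that a path determines. -/
noncomputable def toCompletion (P : Paths zhatSystem.tree) :
    ProfiniteAddGrp.ProfiniteCompletion.completion (AddGrpCat.of ℤ) :=
  -- Approximation up to the index of H fixes the integer modulo that index, so the coset does not
  -- depend on the choice and is compatible with passing to larger subgroups.
  ⟨fun H => (QuotientAddGroup.mk (ApproximatesTo.exists_int P H.toAddSubgroup.index).choose :
      ℤ ⧸ H.toAddSubgroup), fun H H' π =>
    mk_eq_of_approximatesTo P H' (Nat.le_of_dvd (Nat.pos_of_ne_zero (index_ne_zero H))
      (AddSubgroup.index_dvd_of_le (CategoryTheory.leOfHom π)))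
      (ApproximatesTo.exists_int P _).choose_spec le_rfl
      (ApproximatesTo.exists_int P _).choose_spec⟩

theorem toCompletion_val (P : Paths zhatSystem.tree) (H : FiniteIndexNormalAddSubgroup ℤ)
    {K : ℕ} {z : ℤ} (hK : H.toAddSubgroup.index ≤ K) (hz : ApproximatesTo P K z) :
    (toCompletion P).val H = (QuotientAddGroup.mk z : ℤ ⧸ H.toAddSubgroup) :=
  mk_eq_of_approximatesTo P H le_rfl (ApproximatesTo.exists_int P _).choose_spec hK hz

theorem toCompletion_add (P Q : Paths zhatSystem.tree) :
    toCompletion (P + Q) = toCompletion P + toCompletion Q :=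
  Subtype.ext (funext fun H => toCompletion_val (P + Q) H le_rfl
    ((ApproximatesTo.exists_int P _).choose_spec.add (ApproximatesTo.exists_int Q _).choose_spec))

theorem completion_val_eq_of_le
    (x : ProfiniteAddGrp.ProfiniteCompletion.completion (AddGrpCat.of ℤ))
    {H H' : FiniteIndexNormalAddSubgroup ℤ} (h : H ≤ H') {z : ℤ}
    (hz : x.val H = (QuotientAddGroup.mk z : ℤ ⧸ H.toAddSubgroup)) :
    x.val H' = (QuotientAddGroup.mk z : ℤ ⧸ H'.toAddSubgroup) := by
  rw [← x.2 (CategoryTheory.homOfLE h), hz]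
  rfl

theorem multiplesSubgroup_le {m : ℕ} (hm : m ≠ 0) (H : FiniteIndexNormalAddSubgroup ℤ)
    (h : (m : ℤ) ∈ H.toAddSubgroup) : multiplesSubgroup m hm ≤ H :=
  (AddSubgroup.zmultiples_le_of_mem h : AddSubgroup.zmultiples (m : ℤ) ≤ H.toAddSubgroup)

theorem mk_multiples_eq_iff {m : ℕ} (hm : m ≠ 0) {z w : ℤ} :
    (QuotientAddGroup.mk z : ℤ ⧸ (multiplesSubgroup m hm).toAddSubgroup) =
      QuotientAddGroup.mk w ↔ z ≡ w [ZMOD m] := by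
  rw [QuotientAddGroup.eq, neg_add_eq_sub, Int.modEq_iff_dvd]
  exact Int.mem_zmultiples_iff

/-- The residue at a position is recovered from the coordinate at the subgroup of multiples of the
corresponding prime power. -/
theorem toCompletion_injective : Function.Injective toCompletion := by
  intro P Q h
  refine zhatSystem.path_ext fun j => ?_
  obtain ⟨i, l, rfl⟩ : ∃ i l, j = Nat.pair i l := ⟨_, _, (Nat.pair_unpair j).symm⟩
  have hm : Nat.nth Nat.Prime i ^ (l + 1) ≠ 0 := pow_ne_zero _ (Nat.prime_nth_prime i).ne_zero
  obtain ⟨K, hK, hiK, hlK⟩ : ∃ K, (multiplesSubgroup _ hm).toAddSubgroup.index ≤ K ∧ i < K ∧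
      l ≤ K := ⟨max (multiplesSubgroup _ hm).toAddSubgroup.index (i + l + 1), le_max_left _ _,
        lt_max_of_lt_right (by omega), le_max_of_le_right (by omega)⟩
  obtain ⟨z, hz⟩ := ApproximatesTo.exists_int P K
  obtain ⟨w, hw⟩ := ApproximatesTo.exists_int Q K
  have h1 := (toCompletion_val P _ hK hz).symm.trans
    ((congrArg (fun x => x.val (multiplesSubgroup _ hm)) h).trans (toCompletion_val Q _ hK hw))
  have h2 := (mk_multiples_eq_iff hm).1 h1
  have h3 : zhatSystem.modulus (Nat.pair i l) = Nat.nth Nat.Prime i ^ (l + 1) :=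
    zhatSystem.modulus_idx i l
  rw [h3]
  push_cast at h2 ⊢
  exact ((hz.modEq hiK hlK).symm.trans h2).trans (hw.modEq hiK hlK)

theorem toCompletion_surjective : Function.Surjective toCompletion := by
  intro x
  have hrep : ∀ H : FiniteIndexNormalAddSubgroup ℤ, ∃ z : ℤ,
      x.val H = (QuotientAddGroup.mk z : ℤ ⧸ H.toAddSubgroup) := fun H =>
    ⟨_, (QuotientAddGroup.mk_surjective (s := H.toAddSubgroup) (x.val H)).choose_spec.symm⟩
  choose rep hrep using hrep
  have hq : ∀ i l, Nat.nth Nat.Prime i ^ (l + 1) ≠ 0 := fun i l =>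
    pow_ne_zero _ (Nat.prime_nth_prime i).ne_zero
  have hmod : ∀ (m m' : ℕ) (hm : m ≠ 0) (hm' : m' ≠ 0), m' ∣ m →
      rep (multiplesSubgroup m hm) ≡ rep (multiplesSubgroup m' hm') [ZMOD m'] := by
    intro m m' hm hm' hdvd
    rw [← mk_multiples_eq_iff hm', ← hrep]
    refine (completion_val_eq_of_le x (multiplesSubgroup_le hm _ ?_) (hrep _)).symm
    exact Int.mem_zmultiples_iff.2 (Int.natCast_dvd_natCast.2 hdvd)
  -- The preimage is read off from the coordinates of x at the multiples of prime powers. At a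
  -- general H, x is determined by its coordinate at the multiples of the index of H, and there
  -- divisibility is checked on prime powers.
  obtain ⟨P, hP⟩ : ∃ P : Paths zhatSystem.tree, ∀ i l, (P.1 (Nat.pair i l) : ℤ) ≡
      rep (multiplesSubgroup _ (hq i l)) [ZMOD (Nat.nth Nat.Prime i : ℤ) ^ (l + 1)] := by
    have hcond := zhatSystem.mkPath_condition (fun i l => rep (multiplesSubgroup _ (hq i l)))
      (fun i l => by
        have := hmod _ _ (hq i (l + 1)) (hq i l) (pow_dvd_pow _ (Nat.le_succ _))
        exact_mod_cast this)
      fun i l l' => by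
        have : zhatSystem.comp (zhatSystem.idx i l) = i := by
          change (Nat.pair i l).unpair.1 = i
          rw [Nat.unpair_pair]
        rw [this]
    refine ⟨zhatSystem.mkPath _ hcond, fun i l => ?_⟩
    have h1 := zhatSystem.coe_mkPath _ hcond (Nat.pair i l)
    have h2 : zhatSystem.modulus (Nat.pair i l) = Nat.nth Nat.Prime i ^ (l + 1) :=
      zhatSystem.modulus_idx i l
    have h3 : zhatSystem.comp (Nat.pair i l) = i := congrArg Prod.fst (Nat.unpair_pair i l)
    have h4 : zhatSystem.lvl (Nat.pair i l) = l := congrArg Prod.snd (Nat.unpair_pair i l)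
    rw [h1, h2, h3, h4]
    push_cast
    exact Int.mod_modEq _ _
  refine ⟨P, Subtype.ext (funext fun H => ?_)⟩
  have hm := index_ne_zero H
  obtain ⟨z, hz⟩ := ApproximatesTo.exists_int P H.toAddSubgroup.index
  refine (toCompletion_val P H le_rfl hz).trans ?_
  rw [completion_val_eq_of_le x (multiplesSubgroup_le hm H (mem_of_index_dvd H dvd_rfl)) (hrep _)]
  refine QuotientAddGroup.eq.2 (mem_of_index_dvd H ?_)
  rw [neg_add_eq_sub, ← dvd_neg, neg_sub]
  refine hz.dvd_sub hm le_rfl fun i l hil => ?_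
  refine Int.ModEq.trans ?_ (hP i l).symm
  exact_mod_cast hmod _ _ hm (hq i l) hil

/-- The paths of the product tree form the profinite completion of `ℤ`. -/
theorem nonempty_paths_addEquiv_completion : Nonempty (Paths zhatSystem.tree ≃+
    ProfiniteAddGrp.ProfiniteCompletion.completion (AddGrpCat.of ℤ)) :=
  ⟨AddEquiv.ofBijective (AddMonoidHom.mk' toCompletion toCompletion_add)
    ⟨toCompletion_injective, toCompletion_surjective⟩⟩

theorem mainTheorem8 :
    (∀ (T : Set (List ℕ)) [AddCommGroup (Paths T)], SkolemSetting T →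
      HasConjunctiveSkolemFunctions T) ∧
    (∀ (p : ℕ) [Fact p.Prime], ∃ _ : AddCommGroup (Paths (padicTree p)),
      (∀ (P Q : Paths (padicTree p)) (i : ℕ), (P + Q).1 i = (P.1 i + Q.1 i) % p ^ (i + 1)) ∧
      Nonempty (Paths (padicTree p) ≃+ ℤ_[p]) ∧
      SkolemSetting (padicTree p) ∧
      HasConjunctiveSkolemFunctions (padicTree p)) ∧
    (∃ _ : AddCommGroup (Paths zhatTree),
      (∀ (P Q : Paths zhatTree) (i l : ℕ), (P + Q).1 (Nat.pair i l) =
        (P.1 (Nat.pair i l) + Q.1 (Nat.pair i l)) % (Nat.nth Nat.Prime i) ^ (l + 1)) ∧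
      Nonempty (Paths zhatTree ≃+
        ProfiniteAddGrp.ProfiniteCompletion.completion (AddGrpCat.of ℤ)) ∧
      SkolemSetting zhatTree ∧
      HasConjunctiveSkolemFunctions zhatTree) := by
  refine ⟨fun T _ h => h.hasConjunctiveSkolemFunctions, fun p hp => ?_, ?_⟩
  · rw [padicTree_eq p hp.out]
    exact ⟨inferInstance, (padicSystem p hp.out).add_apply, nonempty_paths_addEquiv_padicInt p,
      (padicSystem p hp.out).skolemSetting,
      (padicSystem p hp.out).skolemSetting.hasConjunctiveSkolemFunctions⟩
  · rw [zhatTree_eq]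
    refine ⟨inferInstance, fun P Q i l => ?_, nonempty_paths_addEquiv_completion,
      zhatSystem.skolemSetting, zhatSystem.skolemSetting.hasConjunctiveSkolemFunctions⟩
    rw [zhatSystem.add_apply]
    exact congrArg _ (zhatSystem.modulus_idx i l)
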